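/- Let $\gamma$ be a smooth ($C^\infty$), regular, simple closed curve in the hyperbolic plane $\mathbb H^2$ (of curvature $-1$), oriented counterclockwise, and suppose that $\gamma$ is horocyclically convex, that is, its geodesic curvature $k$ (with respect to the inward normal) satisfies $k>1$ everywhere. Let $L$ be the hyperbolic length of $\gamma$ and $A$ the hyperbolic area of the region bounded by $\gamma$. Then the average curvature with respect to the arc length parameter $s$ is $$\bar k=\frac1L\int_\gamma k\,ds=\frac{2\pi+A}{L},$$ and there are at least four distinct points of $\gamma$ at which $k=\bar k$. -/

import Mathlib

open UpperHalfPlane MeasureTheory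
open scoped ContDiff

noncomputable section

namespace HypCurve

/-- The hyperbolic metric `(dx² + dy²) / y²` of the upper half-plane (curvature `-1`) at the
point `z`, evaluated on the tangent vectors `u`, `v`; the tangent plane at `z` is `ℂ`. -/
def metric (z : ℍ) (u v : ℂ) : ℝ :=
  (u.re * v.re + u.im * v.im) / z.im ^ 2

/-- The velocity vector of a curve. -/
def velocity (γ : ℝ → ℍ) (t : ℝ) : ℂ :=
  deriv (fun s => (γ s : ℂ)) t

/-- The hyperbolic length of the velocity vector. -/
def speed (γ : ℝ → ℍ) (t : ℝ) : ℝ :=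
  Real.sqrt (metric (γ t) (velocity γ t) (velocity γ t))

/-- The covariant derivative (Levi-Civita connection of the hyperbolic metric) of the velocity
along the curve. The nonzero Christoffel symbols are `Γˣₓᵧ = Γˣᵧₓ = -1/y`, `Γʸₓₓ = 1/y`,
`Γʸᵧᵧ = -1/y`, so the components are `x'' - 2 x' y' / y` and `y'' + (x'² - y'²) / y`. -/
def covariantAcceleration (γ : ℝ → ℍ) (t : ℝ) : ℂ :=
  { re := (deriv (velocity γ) t).re
      - 2 * (velocity γ t).re * (velocity γ t).im / (γ t).im
    im := (deriv (velocity γ) t).im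
      + ((velocity γ t).re ^ 2 - (velocity γ t).im ^ 2) / (γ t).im }

/-- The signed geodesic curvature `⟨∇_{γ'} γ', J γ'⟩ / |γ'|³` of a regular curve with respect to
its left normal; `J`, the rotation by `90°` counterclockwise, is multiplication by `i`. -/
def curvature (γ : ℝ → ℍ) (t : ℝ) : ℝ :=
  metric (γ t) (covariantAcceleration γ t) (Complex.I * velocity γ t) / speed γ t ^ 3

/-- `γ` is a smooth regular parametrization, of period `P`, of a simple closed curve. -/
structure IsSimpleClosed (γ : ℝ → ℍ) (P : ℝ) : Prop where
  period_pos : 0 < P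
  smooth : ContDiff ℝ ∞ (fun t => (γ t : ℂ))
  regular : ∀ t, velocity γ t ≠ 0
  periodic : Function.Periodic γ P
  injOn : Set.InjOn γ (Set.Ico 0 P)

/-- The hyperbolic length of the closed curve `γ` of period `P`. -/
def length (γ : ℝ → ℍ) (P : ℝ) : ℝ :=
  ∫ t in (0 : ℝ)..P, speed γ t

/-- The region bounded by a closed curve: the union of the bounded connected components of the
complement of the curve. -/
def inside (γ : ℝ → ℍ) : Set ℍ :=
  {z | z ∈ (Set.range γ)ᶜ ∧ Bornology.IsBounded (connectedComponentIn (Set.range γ)ᶜ z)}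

/-- The hyperbolic area bounded by a closed curve (`volume` on `ℍ` is `dx dy / y²`). -/
def area (γ : ℝ → ℍ) : ℝ :=
  (volume (inside γ)).toReal

/-- The average of the curvature with respect to hyperbolic arc length. -/
def averageCurvature (γ : ℝ → ℍ) (P : ℝ) : ℝ :=
  (∫ t in (0 : ℝ)..P, curvature γ t * speed γ t) / length γ P

end HypCurve

end

namespace HypCurve

/-! Let `ψ` be the Euclidean angle of the tangent and `σ` the hyperbolic speed. The conformal change
of metric gives `k σ = ψ' + σ cos ψ`. Since `k > 1`, `ψ` is strictly increasing, so the curve is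
locally convex in the Euclidean sense and runs counterclockwise; by Hopf's Umlaufsatz
(`angle_add_period_of_simple`) `ψ` gains `2π` in each period. The curve then consists of a lower and
an upper graph, and `∮ σ cos ψ dt = ∮ dx / y` is the enclosed area. Integrating `k σ` gives the
Gauss–Bonnet formula and hence the mean `C`.

For the four points, `k - C` is orthogonal with respect to arc length to a four-dimensional space:
the constants, and the normal components `⟨X, N⟩` of the Killing fields `X = 1, z, z²`. Indeed `k N
= ∇_T T` makes `k ⟨X, N⟩` the derivative of `⟨X, T⟩`, while `∮ ⟨X, N⟩ ds = 0` because `X` has no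
divergence (`integral_mul_eq_zero`).

This space contains, for any `p` and `q`, a function changing sign exactly at `p` and `q`: the
product of a determinant comparing the ideal endpoints of the inward normal rays at `p` and `t` with
one comparing the outward endpoints at `q` and `t`. There are no further zeros because both
endpoints travel monotonically once around the circle at infinity; for the inward one this is
precisely `k > 1`. Hence `k - C` cannot have opposite signs on two complementary arcs
(`eq_of_two_arcs`), whereas at most three zeros would force such a pattern. -/

/-- A closed curve `x + i y` in the upper half-plane which turns once, described by its
hyperbolic speed `σ`, the Euclidean angle `ψ` of its tangent and its geodesic curvature `k`,
where `k > 1`. -/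
structure FramedLoop (x y ψ σ k : ℝ → ℝ) (P : ℝ) : Prop where
  period_pos : 0 < P
  im_pos : ∀ t, 0 < y t
  speed_pos : ∀ t, 0 < σ t
  one_lt_curvature : ∀ t, 1 < k t
  continuous_speed : Continuous σ
  continuous_curvature : Continuous k
  hasDerivAt_re : ∀ t, HasDerivAt x (y t * σ t * Real.cos (ψ t)) t
  hasDerivAt_im : ∀ t, HasDerivAt y (y t * σ t * Real.sin (ψ t)) t
  hasDerivAt_angle : ∀ t, HasDerivAt ψ (σ t * (k t - Real.cos (ψ t))) t
  periodic_re : Function.Periodic x P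
  periodic_im : Function.Periodic y P
  periodic_speed : Function.Periodic σ P
  periodic_curvature : Function.Periodic k P
  angle_add_period : ∀ t, ψ (t + P) = ψ t + 2 * Real.pi

/-! ### Logarithms and continuous angles -/

/-- A differentiable nonvanishing complex function of a real variable has a logarithm. -/
lemma exists_log_of_hasDerivAt {v v' : ℝ → ℂ} (hv : ∀ t, HasDerivAt v (v' t) t)
    (hv' : Continuous v') (h0 : ∀ t, v t ≠ 0) :
    ∃ L : ℝ → ℂ, (∀ t, HasDerivAt L (v' t / v t) t) ∧ ∀ t, Complex.exp (L t) = v t := by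
  have hvc : Continuous v := continuous_iff_continuousAt.2 fun t => (hv t).continuousAt
  have hc : Continuous fun t => v' t / v t := hv'.div hvc h0
  have hL : ∀ t, HasDerivAt (fun t => Complex.log (v 0) + ∫ r in (0 : ℝ)..t, v' r / v r)
      (v' t / v t) t := fun t => (hc.integral_hasStrictDerivAt 0 t).hasDerivAt.const_add _
  refine ⟨_, hL, ?_⟩
  have hq : ∀ t, HasDerivAt (fun t => Complex.exp (Complex.log (v 0) +
      ∫ r in (0 : ℝ)..t, v' r / v r) / v t) 0 t := by
    intro t
    refine ((hL t).cexp.div (hv t) (h0 t)).congr_deriv ?_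
    have := h0 t
    field_simp
    ring
  intro t
  have := is_const_of_deriv_eq_zero (fun t => (hq t).differentiableAt) (fun t => (hq t).deriv) t 0
  simp only [intervalIntegral.integral_same, add_zero, Complex.exp_log (h0 0), div_self (h0 0)]
    at this
  exact (div_eq_one_iff_eq (h0 t)).1 this

/-- A continuous nonvanishing function on a convex set has a continuous logarithm. -/
lemma exists_continuousOn_log {S : Set (ℝ × ℝ)} (hS : Convex ℝ S) {f : ℝ × ℝ → ℂ}
    (hf : ContinuousOn f S) (h0 : ∀ p ∈ S, f p ≠ 0) :
    ∃ L : ℝ × ℝ → ℂ, ContinuousOn L S ∧ ∀ p ∈ S, Complex.exp (L p) = f p := by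
  classical
  rcases S.eq_empty_or_nonempty with rfl | ⟨a, ha⟩
  · exact ⟨0, by simp, by simp⟩
  have := hS.contractibleSpace ⟨a, ha⟩
  have : LocallyPathConnectedSpace S := hS.locallyPathConnectedSpace
  obtain ⟨F, ⟨-, hF⟩, -⟩ := Complex.isCoveringMapOn_exp.existsUnique_continuousMap_lifts
    (⟨S.domRestrict f, hf.domRestrict⟩ : C(S, ℂ)) (a₀ := ⟨a, ha⟩) (e₀ := Complex.log (f a))
    (Complex.exp_log (h0 a ha)) (fun p => h0 p p.2)
  refine ⟨fun p => if h : p ∈ S then F ⟨p, h⟩ else 0, ?_, ?_⟩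
  · rw [continuousOn_iff_continuous_domRestrict]
    refine F.continuous.congr fun p => ?_
    simp
  · intro p hp
    have : Complex.exp (F ⟨p, hp⟩) = f p := congr_fun hF ⟨p, hp⟩
    simpa only [dif_pos hp] using this

/-- Two angle functions on a preconnected set whose difference is constant modulo `2π` differ by
a constant. -/
lemma angle_sub_eq_of_exp {X : Type*} [TopologicalSpace X] {S : Set X} (hS : IsPreconnected S)
    {f g : X → ℝ} (hf : ContinuousOn f S) (hg : ContinuousOn g S) {c : ℂ}
    (h : ∀ p ∈ S, Complex.exp (f p * Complex.I) = c * Complex.exp (g p * Complex.I))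
    {p q : X} (hp : p ∈ S) (hq : q ∈ S) : f p - g p = f q - g q := by
  have hc : ∀ r ∈ S, Complex.exp ((f r - g r : ℝ) * Complex.I) = c := by
    intro r hr
    push_cast
    rw [sub_mul, Complex.exp_sub, h r hr, mul_div_assoc, div_self (Complex.exp_ne_zero _), mul_one]
  wlog hlt : f p - g p < f q - g q generalizing p q
  · rcases (not_lt.1 hlt).lt_or_eq with h1 | h1
    · exact (this hq hp h1).symm
    · exact h1.symm
  -- The increment is capped at `π`, so that `cos δ = 1` leaves only `δ = 0`.
  have hδ : 0 < min Real.pi (f q - g q - (f p - g p)) := lt_min Real.pi_pos (by linarith)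
  set δ := min Real.pi (f q - g q - (f p - g p)) with hδ'
  have hδπ : δ ≤ Real.pi := min_le_left _ _
  have hδq : δ ≤ f q - g q - (f p - g p) := min_le_right _ _
  obtain ⟨r, hr, hr'⟩ := hS.intermediate_value hp hq (hf.sub hg)
    (show f p - g p + δ ∈ Set.Icc (f p - g p) (f q - g q) from ⟨by linarith, by linarith⟩)
  have h1 := hc r hr
  rw [show f r - g r = f p - g p + δ from hr', Complex.ofReal_add, add_mul, Complex.exp_add,
    hc p hp] at h1
  have hc0 : c ≠ 0 := by rw [← hc p hp]; exact Complex.exp_ne_zero _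
  have h2 : Complex.exp (δ * Complex.I) = 1 := by simpa [hc0] using h1
  have h3 : Real.cos δ = 1 := by
    rw [← Complex.exp_ofReal_mul_I_re, h2, Complex.one_re]
  have := (Real.cos_eq_one_iff_of_lt_of_lt (by linarith) (by linarith [Real.pi_pos])).1 h3
  linarith

/-- A continuous angle on an interval whose sine is nonnegative and which starts at `0` stays
in `[0, π]`. -/
lemma angle_mem_Icc_of_sin_nonneg {S : Set ℝ} (hS : IsPreconnected S) {f : ℝ → ℝ}
    (hf : ContinuousOn f S) (hsin : ∀ t ∈ S, 0 ≤ Real.sin (f t)) {a : ℝ} (ha : a ∈ S)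
    (hfa : f a = 0) {t : ℝ} (ht : t ∈ S) : f t ∈ Set.Icc 0 Real.pi := by
  have hpi := Real.pi_pos
  constructor
  · by_contra! hlt
    have hm : max (f t) (-(Real.pi / 2)) ∈ Set.Icc (f t) (f a) :=
      ⟨le_max_left _ _, by rw [hfa]; exact max_le hlt.le (by linarith)⟩
    obtain ⟨r, hr, hr'⟩ := hS.intermediate_value ht ha hf hm
    have h1 := hsin r hr
    rw [hr'] at h1
    have := Real.sin_neg_of_neg_of_neg_pi_lt (max_lt hlt (by linarith : -(Real.pi / 2) < 0))
      (lt_of_lt_of_le (by linarith) (le_max_right _ _))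
    linarith
  · by_contra! hlt
    have hm : min (f t) (3 * Real.pi / 2) ∈ Set.Icc (f a) (f t) :=
      ⟨by rw [hfa]; exact le_min (by linarith) (by linarith), min_le_left _ _⟩
    obtain ⟨r, hr, hr'⟩ := hS.intermediate_value ha ht hf hm
    have h1 := hsin r hr
    have h2 : Real.pi < min (f t) (3 * Real.pi / 2) := lt_min hlt (by linarith)
    have h3 : min (f t) (3 * Real.pi / 2) ≤ 3 * Real.pi / 2 := min_le_right _ _
    rw [hr', ← sub_add_cancel (min (f t) (3 * Real.pi / 2)) Real.pi, Real.sin_add_pi] at h1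
    have := Real.sin_pos_of_pos_of_lt_pi (x := min (f t) (3 * Real.pi / 2) - Real.pi)
      (by linarith) (by linarith)
    linarith

/-! ### Hopf's Umlaufsatz -/

/-- The average velocity of a curve over `[s, t]`, where `p = (s, t)`. -/
noncomputable def meanVelocity (v : ℝ → ℂ) (p : ℝ × ℝ) : ℂ :=
  ∫ r in (0 : ℝ)..1, v (p.1 + r * (p.2 - p.1))

lemma continuous_meanVelocity {v : ℝ → ℂ} (hv : Continuous v) : Continuous (meanVelocity v) := by
  refine intervalIntegral.continuous_parametric_intervalIntegral_of_continuous' ?_ 0 1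
  fun_prop

lemma meanVelocity_self (v : ℝ → ℂ) (s : ℝ) : meanVelocity v (s, s) = v s := by
  simp [meanVelocity]

/-- For `s < t` the mean velocity has the direction of the secant, and it extends this direction
continuously to the diagonal, where it is the tangent. -/
lemma sub_mul_meanVelocity {z v : ℝ → ℂ} (hz : ∀ t, HasDerivAt z (v t) t) (hv : Continuous v)
    (s t : ℝ) : ((t - s : ℝ) : ℂ) * meanVelocity v (s, t) = z t - z s := by
  have h := intervalIntegral.integral_eq_sub_of_hasDerivAt (a := 0) (b := 1)
    (f := fun r : ℝ => z (s + r * (t - s)))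
    (f' := fun r : ℝ => ((t - s : ℝ) : ℂ) * v (s + r * (t - s))) (fun r _ => ?_)
    (by apply Continuous.intervalIntegrable; fun_prop)
  · rw [intervalIntegral.integral_const_mul] at h
    simpa [meanVelocity] using h
  · have h1 : HasDerivAt (fun r : ℝ => s + r * (t - s)) (t - s) r := by
      simpa using ((hasDerivAt_id r).mul_const (t - s)).const_add s
    simpa [Function.comp_def] using (hz (s + r * (t - s))).scomp r h1

/-- The rotation index of a simple closed plane curve is one. -/
theorem angle_add_period_of_simple {z v : ℝ → ℂ} {P : ℝ} (hP : 0 < P)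
    (hz : ∀ t, HasDerivAt z (v t) t) (hv : Continuous v) (hv0 : ∀ t, v t ≠ 0)
    (hzP : Function.Periodic z P) (hvP : Function.Periodic v P)
    (hsimple : ∀ s t, s < t → t < s + P → z s ≠ z t)
    {ψ : ℝ → ℝ} (hψ : Continuous ψ) (hvψ : ∀ t, v t = ‖v t‖ * Complex.exp (ψ t * Complex.I))
    {t₀ : ℝ} (hmin : ∀ t, (z t₀).im ≤ (z t).im) (ht₀ : v t₀ = ‖v t₀‖) (t : ℝ) :
    ψ (t + P) = ψ t + 2 * Real.pi := by
  -- The edge `t = s + P` is left out because the mean velocity vanishes there. The reversal `(s, t)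
  -- ↦ (t, s + P)` takes over the role of that edge.
  set S : Set (ℝ × ℝ) := {p | p.1 ≤ p.2 ∧ p.2 < p.1 + P} with hS
  have hSconv : Convex ℝ S := by
    rintro ⟨a, b⟩ ⟨h1, h2⟩ ⟨c, d⟩ ⟨h3, h4⟩ α β hα hβ hαβ
    simp only at h1 h2 h3 h4
    simp only [hS, Set.mem_ofPred_eq, Prod.smul_mk, Prod.mk_add_mk, smul_eq_mul]
    constructor
    · gcongr
    · rcases hα.eq_or_lt with rfl | hα
      · have : β = 1 := by linarith
        subst this; linarith
      · nlinarith [mul_lt_mul_of_pos_left h2 hα, mul_le_mul_of_nonneg_left h4.le hβ]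
  have hG0 : ∀ p ∈ S, meanVelocity v p ≠ 0 := by
    rintro ⟨s, t⟩ ⟨h1, h2⟩ h0
    simp only at h1 h2
    rcases h1.eq_or_lt with rfl | h1
    · exact hv0 s (by rw [← meanVelocity_self v s, h0])
    · refine hsimple s t h1 h2 ?_
      have := sub_mul_meanVelocity hz hv s t
      rw [h0, mul_zero] at this
      exact (sub_eq_zero.1 this.symm).symm
  obtain ⟨Λ, hΛc, hΛ⟩ :=
    exists_continuousOn_log hSconv (continuous_meanVelocity hv).continuousOn hG0
  have ht₀S : (t₀, t₀) ∈ S := ⟨le_rfl, by simpa using hP⟩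
  set Θ : ℝ × ℝ → ℝ := fun p => (Λ p).im - (Λ (t₀, t₀)).im with hΘ
  have hΘc : ContinuousOn Θ S :=
    (Complex.continuous_im.comp_continuousOn hΛc).sub continuousOn_const
  have hΘ0 : Θ (t₀, t₀) = 0 := sub_self _
  have hnexp : ∀ w : ℂ, Complex.exp w = ‖Complex.exp w‖ * Complex.exp (w.im * Complex.I) := by
    intro w
    rw [Complex.norm_exp, Complex.ofReal_exp, ← Complex.exp_add, Complex.re_add_im]
  have hbase : Complex.exp ((Λ (t₀, t₀)).im * Complex.I) = 1 := by
    have h1 := hnexp (Λ (t₀, t₀))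
    rw [hΛ _ ht₀S, meanVelocity_self] at h1
    rw [← ht₀] at h1
    nth_rewrite 1 [← mul_one (v t₀)] at h1
    exact (mul_left_cancel₀ (hv0 t₀) h1).symm
  have hGΘ : ∀ p ∈ S, meanVelocity v p = ‖meanVelocity v p‖ * Complex.exp (Θ p * Complex.I) := by
    intro p hp
    have h1 := hnexp (Λ p)
    rw [hΛ p hp] at h1
    rw [hΘ]
    push_cast
    rw [sub_mul, Complex.exp_sub, hbase, div_one]
    exact h1
  -- secants from the lowest point
  have hlow : ∀ t ∈ Set.Ico t₀ (t₀ + P), Θ (t₀, t) ∈ Set.Icc 0 Real.pi := by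
    have hmaps : Set.MapsTo (fun t : ℝ => (t₀, t)) (Set.Ico t₀ (t₀ + P)) S := fun t ht => ht
    intro t ht
    refine angle_mem_Icc_of_sin_nonneg isPreconnected_Ico
      (f := fun t => Θ (t₀, t)) (hΘc.comp (by fun_prop) hmaps) ?_
      (a := t₀) ⟨le_rfl, by linarith⟩ hΘ0 ht
    intro u hu
    rcases hu.1.eq_or_lt with rfl | hu1
    · rw [hΘ0]; simp
    have h1 := sub_mul_meanVelocity hz hv t₀ u
    rw [hGΘ _ (hmaps hu)] at h1
    have h2 := congrArg Complex.im h1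
    rw [← mul_assoc, ← Complex.ofReal_mul, Complex.im_ofReal_mul, Complex.exp_ofReal_mul_I_im,
      Complex.sub_im] at h2
    have h3 : 0 < ‖meanVelocity v (t₀, u)‖ := norm_pos_iff.2 (hG0 _ (hmaps hu))
    have h4 : 0 < (u - t₀) * ‖meanVelocity v (t₀, u)‖ := mul_pos (by linarith) h3
    have h5 := hmin u
    by_contra! hneg
    nlinarith
  -- reversal of secants
  set S' : Set (ℝ × ℝ) := {p | p.1 < p.2 ∧ p.2 < p.1 + P} with hS'
  have hS'S : S' ⊆ S := fun p hp => ⟨hp.1.le, hp.2⟩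
  have hS'conv : Convex ℝ S' := by
    rintro ⟨a, b⟩ ⟨h1, h2⟩ ⟨c, d⟩ ⟨h3, h4⟩ α β hα hβ hαβ
    simp only at h1 h2 h3 h4
    simp only [hS', Set.mem_ofPred_eq, Prod.smul_mk, Prod.mk_add_mk, smul_eq_mul]
    rcases hα.eq_or_lt with rfl | hα
    · have : β = 1 := by linarith
      subst this; constructor <;> linarith
    · constructor
      · nlinarith [mul_lt_mul_of_pos_left h1 hα, mul_le_mul_of_nonneg_left h3.le hβ]
      · nlinarith [mul_lt_mul_of_pos_left h2 hα, mul_le_mul_of_nonneg_left h4.le hβ]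
  have hflip : Set.MapsTo (fun p : ℝ × ℝ => (p.2, p.1 + P)) S' S' := by
    rintro ⟨s, t⟩ ⟨h1, h2⟩
    exact ⟨h2, by simpa using h1⟩
  have hrev : ∀ p ∈ S', Complex.exp (Θ (p.2, p.1 + P) * Complex.I)
      = -1 * Complex.exp (Θ p * Complex.I) := by
    rintro ⟨s, t⟩ hp
    have h1 := sub_mul_meanVelocity hz hv s t
    have h2 := sub_mul_meanVelocity hz hv t (s + P)
    rw [hzP s] at h2
    rw [hGΘ _ (hS'S hp), ← mul_assoc, ← Complex.ofReal_mul] at h1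
    rw [hGΘ _ (hS'S (hflip hp)), ← mul_assoc, ← Complex.ofReal_mul] at h2
    have p1 : 0 < (t - s) * ‖meanVelocity v (s, t)‖ :=
      mul_pos (sub_pos.2 hp.1) (norm_pos_iff.2 (hG0 _ (hS'S hp)))
    have p2 : 0 < (s + P - t) * ‖meanVelocity v (t, s + P)‖ :=
      mul_pos (sub_pos.2 hp.2) (norm_pos_iff.2 (hG0 _ (hS'S (hflip hp))))
    have h3 := h2.trans ((neg_sub _ _).symm.trans (congrArg Neg.neg h1.symm))
    have h4 := congrArg norm h3
    rw [norm_neg, norm_mul, norm_mul, Complex.norm_exp_ofReal_mul_I,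
      Complex.norm_exp_ofReal_mul_I, mul_one, mul_one, Complex.norm_of_nonneg p1.le,
      Complex.norm_of_nonneg p2.le] at h4
    rw [h4, ← mul_neg] at h3
    have h5 := mul_left_cancel₀ (Complex.ofReal_ne_zero.2 p1.ne') h3
    simpa using h5
  have hrevc : ∀ p ∈ S', ∀ q ∈ S',
      Θ (p.2, p.1 + P) - Θ p = Θ (q.2, q.1 + P) - Θ q := fun p hp q hq =>
    angle_sub_eq_of_exp hS'conv.isPreconnected (f := fun p => Θ (p.2, p.1 + P))
      ((hΘc.mono hS'S).comp (by fun_prop) hflip) (hΘc.mono hS'S) hrev hp hq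
  have hmid : (t₀, t₀ + P / 2) ∈ S' := ⟨by simpa using hP, by simpa using hP⟩
  set c : ℝ := Θ (t₀ + P / 2, t₀ + P) - Θ (t₀, t₀ + P / 2) with hc
  have hrevc' : ∀ s t, s < t → t < s + P → Θ (t, s + P) = Θ (s, t) + c := by
    intro s t h1 h2
    have := hrevc (s, t) ⟨h1, h2⟩ _ hmid
    simp only at this
    linarith
  have hcexp : Complex.exp (c * Complex.I) = -1 := by
    have := hrev _ hmid
    rw [hc]
    push_cast
    rw [sub_mul, Complex.exp_sub, this, mul_div_assoc, div_self (Complex.exp_ne_zero _), mul_one]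
  -- limits at the diagonal
  have hend : (t₀ + P, t₀ + P) ∈ S := ⟨le_rfl, by simpa using hP⟩
  -- Two reversals carry `(t₀, t)` to `(t₀ + P, t + P)` and add `2c` to the angle; then `t`
  -- decreases to `t₀`.
  have h2c : Θ (t₀ + P, t₀ + P) = 2 * c := by
    have hl1 : Filter.Tendsto (fun t => Θ (t₀ + P, t + P)) (nhdsWithin t₀ (Set.Ioo t₀ (t₀ + P)))
        (nhds (Θ (t₀ + P, t₀ + P))) := by
      refine (hΘc _ hend).tendsto.comp (tendsto_nhdsWithin_iff.2 ⟨?_, ?_⟩)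
      · exact (Continuous.tendsto (by fun_prop) t₀ : Filter.Tendsto
          (fun t : ℝ => (t₀ + P, t + P)) (nhds t₀) _).mono_left nhdsWithin_le_nhds
      · filter_upwards [self_mem_nhdsWithin] with t ht
        exact ⟨by simpa using ht.1.le, by simpa using ht.2⟩
    have hl2 : Filter.Tendsto (fun t => Θ (t₀, t) + 2 * c) (nhdsWithin t₀ (Set.Ioo t₀ (t₀ + P)))
        (nhds (Θ (t₀, t₀) + 2 * c)) := by
      refine ((hΘc _ ht₀S).tendsto.comp (tendsto_nhdsWithin_iff.2 ⟨?_, ?_⟩)).add_const _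
      · exact (Continuous.tendsto (by fun_prop) t₀ : Filter.Tendsto
          (fun t : ℝ => (t₀, t)) (nhds t₀) _).mono_left nhdsWithin_le_nhds
      · filter_upwards [self_mem_nhdsWithin] with t ht
        exact ⟨ht.1.le, ht.2⟩
    have : (nhdsWithin t₀ (Set.Ioo t₀ (t₀ + P))).NeBot := by
      rw [nhdsWithin_Ioo_eq_nhdsGT (by linarith)]; infer_instance
    have := tendsto_nhds_unique (hl1.congr' ?_) hl2
    · rw [this, hΘ0, zero_add]
    · filter_upwards [self_mem_nhdsWithin] with t ht
      rw [hrevc' t (t₀ + P) ht.2 (by linarith [ht.1]), hrevc' t₀ t ht.1 ht.2]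
      ring
  -- A single reversal moves the secants from the lowest point, whose angles lie in `[0, π]`, to
  -- secants ending at `t₀ + P`; then `t` increases to `t₀ + P`. Together with the value `2c` this
  -- confines `c` to `[0, π]`.
  have hcI : Θ (t₀ + P, t₀ + P) ∈ Set.Icc c (c + Real.pi) := by
    have hl : Filter.Tendsto (fun t => Θ (t, t₀ + P))
        (nhdsWithin (t₀ + P) (Set.Ioo t₀ (t₀ + P))) (nhds (Θ (t₀ + P, t₀ + P))) := by
      refine (hΘc _ hend).tendsto.comp (tendsto_nhdsWithin_iff.2 ⟨?_, ?_⟩)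
      · exact (Continuous.tendsto (by fun_prop) _ : Filter.Tendsto
          (fun t : ℝ => (t, t₀ + P)) (nhds (t₀ + P)) _).mono_left nhdsWithin_le_nhds
      · filter_upwards [self_mem_nhdsWithin] with t ht
        exact ⟨ht.2.le, by simpa using ht.1⟩
    have : (nhdsWithin (t₀ + P) (Set.Ioo t₀ (t₀ + P))).NeBot := by
      rw [nhdsWithin_Ioo_eq_nhdsLT (by linarith)]; infer_instance
    refine isClosed_Icc.mem_of_tendsto hl ?_
    filter_upwards [self_mem_nhdsWithin] with t ht
    have h1 := hlow t ⟨ht.1.le, ht.2⟩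
    rw [hrevc' t₀ t ht.1 ht.2]
    exact ⟨by linarith [h1.1], by linarith [h1.2]⟩
  have hcpi : c = Real.pi := by
    rw [h2c] at hcI
    have h0 : 0 ≤ c := by linarith [hcI.1]
    have h1 : c ≤ Real.pi := by linarith [hcI.2]
    refine Real.injOn_cos ⟨h0, h1⟩ ⟨Real.pi_pos.le, le_rfl⟩ ?_
    rw [Real.cos_pi, ← Complex.exp_ofReal_mul_I_re, hcexp]
    simp
  -- transfer to `ψ`
  have hdiag : ∀ s, Complex.exp (Θ (s, s) * Complex.I)
      = 1 * Complex.exp (ψ s * Complex.I) := by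
    intro s
    have hs : (s, s) ∈ S := ⟨le_rfl, by simpa using hP⟩
    have h1 := hGΘ _ hs
    rw [meanVelocity_self] at h1
    have h2 : (‖v s‖ : ℂ) ≠ 0 := by simpa using hv0 s
    rw [one_mul]
    exact mul_left_cancel₀ h2 (h1.symm.trans (hvψ s))
  have hψ₀ : ψ (t₀ + P) = ψ t₀ + 2 * Real.pi := by
    have hdc : Continuous fun s => Θ (s, s) := by
      rw [← continuousOn_univ]
      exact hΘc.comp (f := fun s : ℝ => (s, s)) (by fun_prop)
        (fun s _ => ⟨le_rfl, by simpa using hP⟩)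
    have := angle_sub_eq_of_exp (S := Set.univ) isPreconnected_univ hdc.continuousOn
      hψ.continuousOn (fun s _ => hdiag s) (Set.mem_univ t₀) (Set.mem_univ (t₀ + P))
    rw [hΘ0, h2c, hcpi] at this
    linarith
  have := angle_sub_eq_of_exp (S := Set.univ) isPreconnected_univ (f := fun t => ψ (t + P))
    (g := ψ) (c := 1) (by fun_prop) hψ.continuousOn (fun s _ => ?_) (Set.mem_univ t)
    (Set.mem_univ t₀)
  · linarith
  · have h1 := hvψ (s + P)
    have h2 : (‖v s‖ : ℂ) ≠ 0 := by simpa using hv0 s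
    rw [hvP s] at h1
    rw [one_mul]
    exact mul_left_cancel₀ h2 (h1.symm.trans (hvψ s))


/-! ### From the given curve to a framed loop -/

lemma IsSimpleClosed.injOn_Ico {γ : ℝ → ℍ} {P : ℝ} (hγ : IsSimpleClosed γ P) (a : ℝ) :
    Set.InjOn γ (Set.Ico a (a + P)) := by
  intro s hs t ht h
  have hP := hγ.period_pos
  have hmod : ∀ u, γ (toIcoMod hP 0 u) = γ u := fun u => by
    rw [toIcoMod, hγ.periodic.sub_zsmul_eq]
  have hmem : ∀ u, toIcoMod hP 0 u ∈ Set.Ico 0 P := fun u => by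
    simpa using toIcoMod_mem_Ico hP 0 u
  have h1 : toIcoMod hP 0 s = toIcoMod hP 0 t :=
    hγ.injOn (hmem s) (hmem t) (by rw [hmod, hmod, h])
  have h2 := (toIcoMod_inj hP (c := a)).2 ((toIcoMod_inj hP).1 h1)
  rwa [(toIcoMod_eq_self hP).2 hs, (toIcoMod_eq_self hP).2 ht] at h2

/-- At a lowest point, a counterclockwise locally convex curve points to the right. -/
lemma cos_eq_one_of_isMin {y w ψ : ℝ → ℝ} {t₀ : ℝ} (hw : ∀ t, 0 < w t)
    (hy : ∀ t, HasDerivAt y (w t * Real.sin (ψ t)) t) (hψ : Continuous ψ)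
    (hmono : StrictMono ψ) (hmin : ∀ t, y t₀ ≤ y t) :
    Real.sin (ψ t₀) = 0 ∧ Real.cos (ψ t₀) = 1 := by
  have h0 : w t₀ * Real.sin (ψ t₀) = 0 :=
    IsLocalMin.hasDerivAt_eq_zero (Filter.Eventually.of_forall hmin) (hy t₀)
  have hsin : Real.sin (ψ t₀) = 0 := (mul_eq_zero.1 h0).resolve_left (hw t₀).ne'
  refine ⟨hsin, (Real.sin_eq_zero_iff_cos_eq.1 hsin).resolve_right fun hcos => ?_⟩
  have hev : ∀ᶠ t in nhds t₀, ψ t < ψ t₀ + Real.pi :=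
    hψ.continuousAt.eventually_lt continuousAt_const (by linarith [Real.pi_pos])
  obtain ⟨ε, hε, hball⟩ := Metric.eventually_nhds_iff.1 hev
  -- If the tangent pointed left at the minimum, the increasing angle would turn it below the
  -- horizontal and the height would drop.
  have hanti : StrictAntiOn y (Set.Icc t₀ (t₀ + ε / 2)) := by
    refine strictAntiOn_of_deriv_neg (convex_Icc _ _)
      (fun t _ => (hy t).continuousAt.continuousWithinAt) fun t ht => ?_
    rw [interior_Icc] at ht
    rw [(hy t).deriv]
    refine mul_neg_of_pos_of_neg (hw t) ?_
    have h1 := hmono ht.1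
    have h2 := hball (y := t) (by rw [Real.dist_eq, abs_of_pos] <;> linarith [ht.1, ht.2])
    have h3 := Real.sin_pos_of_pos_of_lt_pi (x := ψ t - ψ t₀) (by linarith) (by linarith)
    rw [Real.sin_sub, hsin, hcos] at h3
    linarith
  have := hanti (Set.left_mem_Icc.2 (by linarith)) (Set.right_mem_Icc.2 (by linarith))
    (by linarith : t₀ < t₀ + ε / 2)
  linarith [hmin (t₀ + ε / 2)]

/-- A horocyclically convex simple closed curve is a framed loop. -/
theorem IsSimpleClosed.exists_framedLoop {γ : ℝ → ℍ} {P : ℝ} (hγ : IsSimpleClosed γ P)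
    (hconv : ∀ t, 1 < curvature γ t) :
    ∃ ψ : ℝ → ℝ, FramedLoop (fun t => (γ t).re) (fun t => (γ t).im) ψ (speed γ)
      (curvature γ) P := by
  have hP := hγ.period_pos
  have hvs : ContDiff ℝ ∞ (velocity γ) := (contDiff_infty_iff_deriv.1 hγ.smooth).2
  have hz : ∀ t, HasDerivAt (fun s => (γ s : ℂ)) (velocity γ t) t := fun t =>
    ((contDiff_infty_iff_deriv.1 hγ.smooth).1 t).hasDerivAt
  have hv : ∀ t, HasDerivAt (velocity γ) (deriv (velocity γ) t) t := fun t =>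
    ((contDiff_infty_iff_deriv.1 hvs).1 t).hasDerivAt
  have hv'c : Continuous (deriv (velocity γ)) := (contDiff_infty_iff_deriv.1 hvs).2.continuous
  have hvc := hvs.continuous
  have hzc : Continuous fun t => (γ t : ℂ) := hγ.smooth.continuous
  have hyc : Continuous fun t => (γ t).im := Complex.continuous_im.comp hzc
  obtain ⟨L, hL, hLv⟩ := exists_log_of_hasDerivAt hv hv'c hγ.regular
  set ψ : ℝ → ℝ := fun t => (L t).im with hψ
  have hψd : ∀ t, HasDerivAt ψ ((deriv (velocity γ) t / velocity γ t).im) t := fun t =>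
    (Complex.imCLM.hasFDerivAt.comp_hasDerivAt t (hL t))
  have hψc : Continuous ψ := continuous_iff_continuousAt.2 fun t => (hψd t).continuousAt
  have hvψ : ∀ t, velocity γ t = ‖velocity γ t‖ * Complex.exp (ψ t * Complex.I) := by
    intro t
    rw [← hLv t, Complex.norm_exp, Complex.ofReal_exp, ← Complex.exp_add, Complex.re_add_im]
  have hy : ∀ t, 0 < (γ t).im := fun t => (γ t).im_pos
  have hn : ∀ t, 0 < ‖velocity γ t‖ := fun t => norm_pos_iff.2 (hγ.regular t)
  have hsp : ∀ t, speed γ t = ‖velocity γ t‖ / (γ t).im := by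
    intro t
    rw [speed, metric, ← pow_two, ← pow_two, Real.sqrt_div' _ (by positivity),
      Real.sqrt_sq (hy t).le, Complex.norm_eq_sqrt_sq_add_sq]
  have hysp : ∀ t, (γ t).im * speed γ t = ‖velocity γ t‖ := fun t => by
    rw [hsp, mul_div_cancel₀ _ (hy t).ne']
  have hre : ∀ t, (velocity γ t).re = (γ t).im * speed γ t * Real.cos (ψ t) := fun t => by
    conv_lhs => rw [hvψ t]
    rw [Complex.re_ofReal_mul, Complex.exp_ofReal_mul_I_re, hysp]
  have him : ∀ t, (velocity γ t).im = (γ t).im * speed γ t * Real.sin (ψ t) := fun t => by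
    conv_lhs => rw [hvψ t]
    rw [Complex.im_ofReal_mul, Complex.exp_ofReal_mul_I_im, hysp]
  have hsp0 : ∀ t, 0 < speed γ t := fun t => by rw [hsp]; exact div_pos (hn t) (hy t)
  -- The left side is `ψ'`, the Euclidean turning rate; the term `-σ cos ψ` comes from the
  -- Christoffel symbols.
  have hk : ∀ t, (deriv (velocity γ) t / velocity γ t).im
      = speed γ t * (curvature γ t - Real.cos (ψ t)) := by
    intro t
    have h1 := hre t
    have h2 := him t
    have h3 := hsp0 t
    have h4 := hy t
    have h5 := Real.sin_sq_add_cos_sq (ψ t)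
    simp only [curvature, metric, covariantAcceleration, Complex.div_im, Complex.normSq_apply,
      Complex.mul_re, Complex.mul_im, Complex.I_re, Complex.I_im]
    rw [h1, h2]
    generalize deriv (velocity γ) t = a at *
    generalize speed γ t = σ at *
    generalize (γ t).im = y at *
    have h6 : y * σ * Real.cos (ψ t) * (y * σ * Real.cos (ψ t)) +
      y * σ * Real.sin (ψ t) * (y * σ * Real.sin (ψ t)) = (y * σ) ^ 2 := by
      linear_combination (y * σ) ^ 2 * h5
    rw [h6]
    field_simp
    linear_combination (-Real.cos (ψ t) * σ ^ 2 * y) * h5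
  have hψd' : ∀ t, HasDerivAt ψ (speed γ t * (curvature γ t - Real.cos (ψ t))) t := fun t =>
    hk t ▸ hψd t
  have hψpos : ∀ t, 0 < speed γ t * (curvature γ t - Real.cos (ψ t)) := fun t =>
    mul_pos (hsp0 t) (by linarith [hconv t, Real.cos_le_one (ψ t)])
  have hψmono : StrictMono ψ := strictMono_of_hasDerivAt_pos hψd' hψpos
  have hxd : ∀ t, HasDerivAt (fun t => (γ t).re) ((γ t).im * speed γ t * Real.cos (ψ t)) t :=
    fun t => hre t ▸ (Complex.reCLM.hasFDerivAt.comp_hasDerivAt t (hz t))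
  have hyd : ∀ t, HasDerivAt (fun t => (γ t).im) ((γ t).im * speed γ t * Real.sin (ψ t)) t :=
    fun t => him t ▸ (Complex.imCLM.hasFDerivAt.comp_hasDerivAt t (hz t))
  have hzP : Function.Periodic (fun t => (γ t : ℂ)) P := fun t => by simp only [hγ.periodic t]
  have hyP : Function.Periodic (fun t => (γ t).im) P := fun t => by simp only [hγ.periodic t]
  have hdP : ∀ f : ℝ → ℂ, Function.Periodic f P → Function.Periodic (deriv f) P := by
    intro f hf t
    rw [← deriv_comp_add_const, show (fun x => f (x + P)) = f from funext hf]
  have hvP : Function.Periodic (velocity γ) P := hdP _ hzP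
  have hv'P := hdP _ hvP
  have hspP : Function.Periodic (speed γ) P := fun t => by rw [hsp, hsp, hvP, hγ.periodic]
  have hspc : Continuous (speed γ) := by
    rw [show speed γ = _ from funext hsp]
    exact hvc.norm.div hyc fun t => (hy t).ne'
  obtain ⟨t₀, ht₀⟩ : ∃ t₀, ∀ t, (γ t₀).im ≤ (γ t).im := by
    obtain ⟨t₀, -, ht₀⟩ := isCompact_Icc.exists_isMinOn (Set.nonempty_Icc.2 hP.le)
      hyc.continuousOn
    refine ⟨t₀, fun t => ?_⟩
    obtain ⟨s, hs, hst⟩ := hyP.exists_mem_Ico₀ hP t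
    rw [hst]
    exact ht₀ ⟨hs.1, hs.2.le⟩
  obtain ⟨hs0, hc1⟩ := cos_eq_one_of_isMin (w := fun t => (γ t).im * speed γ t)
    (fun t => mul_pos (hy t) (hsp0 t)) hyd hψc hψmono ht₀
  have hturn := angle_add_period_of_simple hP hz hvc hγ.regular hzP hvP
    (fun s t h1 h2 h => h1.ne (hγ.injOn_Ico s ⟨le_rfl, by linarith⟩ ⟨h1.le, h2⟩
      (UpperHalfPlane.ext h)))
    hψc hvψ ht₀ (by
      apply Complex.ext
      · rw [hre, hc1, Complex.ofReal_re, ← hysp, mul_one]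
      · rw [him, hs0, Complex.ofReal_im, mul_zero])
  -- Solving for the curvature yields its continuity, and its periodicity now that `ψ` is known to
  -- gain `2π`.
  have hke : ∀ t, curvature γ t =
      (deriv (velocity γ) t / velocity γ t).im / speed γ t + Real.cos (ψ t) := fun t => by
    rw [hk, mul_div_cancel_left₀ _ (hsp0 t).ne', sub_add_cancel]
  exact ⟨ψ, {
    period_pos := hP
    im_pos := hy
    speed_pos := hsp0
    one_lt_curvature := hconv
    continuous_speed := hspc
    continuous_curvature := by
      rw [show curvature γ = _ from funext hke]
      exact ((Complex.continuous_im.comp (hv'c.div hvc hγ.regular)).div hspc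
        fun t => (hsp0 t).ne').add (Real.continuous_cos.comp hψc)
    hasDerivAt_re := hxd
    hasDerivAt_im := hyd
    hasDerivAt_angle := hψd'
    periodic_re := fun t => by simp only [hγ.periodic t]
    periodic_im := hyP
    periodic_speed := hspP
    periodic_curvature := fun t => by
      rw [hke, hke, hv'P, hvP, hspP, hturn, Real.cos_add_two_pi]
    angle_add_period := hturn }⟩


/-! ### Ideal endpoints of the normal rays -/

/-- Writing `a = (x sin φ - y cos φ, sin φ)`, the determinant of `a s` and `a t`. It vanishes when
these vectors represent the same point of the real projective line. -/
noncomputable def gaussDet (x y φ : ℝ → ℝ) (s t : ℝ) : ℝ :=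
  (x t * Real.sin (φ t) - y t * Real.cos (φ t)) * Real.sin (φ s)
    - (x s * Real.sin (φ s) - y s * Real.cos (φ s)) * Real.sin (φ t)

lemma gaussDet_self (x y φ : ℝ → ℝ) (s : ℝ) : gaussDet x y φ s s = 0 := by
  rw [gaussDet, sub_self]

/-- Over one period the representing vector changes sign while its projective point returns. -/
lemma gaussDet_add_period {x y φ : ℝ → ℝ} {P : ℝ} (hx : Function.Periodic x P)
    (hy : Function.Periodic y P) (hφ : ∀ t, φ (t + P) = φ t + Real.pi) (s t : ℝ) :
    gaussDet x y φ s (t + P) = -gaussDet x y φ s t := by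
  simp only [gaussDet, hx t, hy t, hφ t, Real.sin_add_pi, Real.cos_add_pi]
  ring

/-- On `(t₀, t₀ + P)` the projective point has the affine coordinate `x - y cot φ`, and `hW` is the
numerator of its derivative, so it increases. At `t₀` and `t₀ + P` the point is at infinity;
parameters beyond `t₀ + P` are brought back by a period, using antisymmetry. -/
lemma gaussDet_pos_aux {x y φ x' y' φ' : ℝ → ℝ} {P : ℝ}
    (hx : ∀ t, HasDerivAt x (x' t) t) (hy : ∀ t, HasDerivAt y (y' t) t)
    (hφ : ∀ t, HasDerivAt φ (φ' t) t) (hy0 : ∀ t, 0 < y t) (hφ' : ∀ t, 0 < φ' t)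
    (hW : ∀ t, 0 < x' t * Real.sin (φ t) ^ 2 - y' t * Real.sin (φ t) * Real.cos (φ t)
      + y t * φ' t)
    (hxP : Function.Periodic x P) (hyP : Function.Periodic y P)
    (hφP : ∀ t, φ (t + P) = φ t + Real.pi) {t₀ s t : ℝ} (ht₀ : φ t₀ = 0) (hs₀ : t₀ ≤ s)
    (hs₁ : s < t₀ + P) (hst : s < t) (hts : t < s + P) : 0 < gaussDet x y φ s t := by
  have hmono : StrictMono φ := strictMono_of_hasDerivAt_pos hφ hφ'
  have hsin : ∀ u ∈ Set.Ioo t₀ (t₀ + P), 0 < Real.sin (φ u) := by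
    intro u hu
    have h1 := hmono hu.1
    have h2 := hmono hu.2
    rw [hφP, ht₀] at h2
    rw [ht₀] at h1
    exact Real.sin_pos_of_pos_of_lt_pi h1 (by linarith)
  have hE : StrictMonoOn (fun u => x u - y u * Real.cos (φ u) / Real.sin (φ u))
      (Set.Ioo t₀ (t₀ + P)) := by
    have hd : ∀ u ∈ Set.Ioo t₀ (t₀ + P),
        HasDerivAt (fun u => x u - y u * Real.cos (φ u) / Real.sin (φ u))
          ((x' u * Real.sin (φ u) ^ 2 - y' u * Real.sin (φ u) * Real.cos (φ u)
            + y u * φ' u) / Real.sin (φ u) ^ 2) u := by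
      intro u hu
      have h0 := (hsin u hu).ne'
      refine ((hx u).sub (((hy u).mul (hφ u).cos).div (hφ u).sin h0)).congr_deriv ?_
      have := Real.sin_sq_add_cos_sq (φ u)
      simp only [Pi.mul_apply]
      field_simp
      linear_combination (y u * φ' u) * this
    refine strictMonoOn_of_deriv_pos (convex_Ioo _ _)
      (fun u hu => (hd u hu).continuousAt.continuousWithinAt) fun u hu => ?_
    rw [interior_Ioo] at hu
    rw [(hd u hu).deriv]
    exact div_pos (hW u) (pow_pos (hsin u hu) 2)
  have hlt : ∀ u ∈ Set.Ioo t₀ (t₀ + P), ∀ w ∈ Set.Ioo t₀ (t₀ + P), u < w →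
      0 < gaussDet x y φ u w := by
    intro u hu w hw huw
    have h1 := hE hu hw huw
    have h2 := hsin u hu
    have h3 := hsin w hw
    have h4 : gaussDet x y φ u w = Real.sin (φ u) * Real.sin (φ w) *
        ((x w - y w * Real.cos (φ w) / Real.sin (φ w))
          - (x u - y u * Real.cos (φ u) / Real.sin (φ u))) := by
      rw [gaussDet]
      field_simp
    rw [h4]
    exact mul_pos (mul_pos h2 h3) (sub_pos.2 h1)
  rcases hs₀.eq_or_lt with rfl | hs₀
  · have h1 := hsin t ⟨hst, hts⟩
    rw [gaussDet, ht₀, Real.sin_zero, Real.cos_zero]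
    have := mul_pos (hy0 t₀) h1
    linarith
  · rcases lt_trichotomy t (t₀ + P) with h | rfl | h
    · exact hlt s ⟨hs₀, hs₁⟩ t ⟨hs₀.trans hst, h⟩ hst
    · rw [gaussDet_add_period hxP hyP hφP, gaussDet, ht₀, Real.sin_zero, Real.cos_zero]
      have := mul_pos (hy0 t₀) (hsin s ⟨hs₀, hs₁⟩)
      linarith
    · have h1 := hlt (t - P) ⟨by linarith, by linarith⟩ s ⟨hs₀, hs₁⟩ (by linarith)
      have h2 := gaussDet_add_period hxP hyP hφP s (t - P)
      rw [sub_add_cancel] at h2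
      rw [h2]
      simp only [gaussDet] at h1 ⊢
      linarith

/-- If the projective point `a t` moves monotonically once around the projective line during a
period, then `a s` and `a t` are distinct and positively oriented for `s < t < s + P`. -/
lemma gaussDet_pos {x y φ x' y' φ' : ℝ → ℝ} {P : ℝ}
    (hx : ∀ t, HasDerivAt x (x' t) t) (hy : ∀ t, HasDerivAt y (y' t) t)
    (hφ : ∀ t, HasDerivAt φ (φ' t) t) (hy0 : ∀ t, 0 < y t) (hφ' : ∀ t, 0 < φ' t)
    (hW : ∀ t, 0 < x' t * Real.sin (φ t) ^ 2 - y' t * Real.sin (φ t) * Real.cos (φ t)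
      + y t * φ' t)
    (hxP : Function.Periodic x P) (hyP : Function.Periodic y P)
    (hφP : ∀ t, φ (t + P) = φ t + Real.pi) {s t : ℝ} (hst : s < t) (hts : t < s + P) :
    0 < gaussDet x y φ s t := by
  have hpi := Real.pi_pos
  -- Subtracting `nπ` from `φ` places the passage through infinity at some `t₀` with `s - P < t₀ ≤
  -- s`. The sign `(-1) ^ n` enters the determinant twice and cancels.
  set n : ℤ := ⌊φ s / Real.pi⌋ with hn
  have h1 : n * Real.pi ≤ φ s := (le_div_iff₀ hpi).1 (Int.floor_le _)
  have h2 : φ s < (n + 1) * Real.pi := (div_lt_iff₀ hpi).1 (Int.lt_floor_add_one _)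
  have h3 : φ (s - P) = φ s - Real.pi := by
    have := hφP (s - P)
    rw [sub_add_cancel] at this
    linarith
  have hφc : Continuous φ := continuous_iff_continuousAt.2 fun t => (hφ t).continuousAt
  obtain ⟨t₀, ht₀, ht₀'⟩ := intermediate_value_Icc (by linarith : s - P ≤ s) hφc.continuousOn
    (show (n : ℝ) * Real.pi ∈ Set.Icc (φ (s - P)) (φ s) from ⟨by rw [h3]; linarith, h1⟩)
  have ht₁ : s - P < t₀ := by
    refine ht₀.1.lt_of_ne fun h => ?_
    rw [← h, h3] at ht₀'
    linarith
  have hsq : ((-1 : ℝ) ^ n) * ((-1 : ℝ) ^ n) = 1 := by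
    rw [← mul_zpow]; simp
  have hsinn : ∀ u, Real.sin (φ u - n * Real.pi) = (-1) ^ n * Real.sin (φ u) := fun u =>
    Real.sin_sub_int_mul_pi _ _
  have hcosn : ∀ u, Real.cos (φ u - n * Real.pi) = (-1) ^ n * Real.cos (φ u) := fun u =>
    Real.cos_sub_int_mul_pi _ _
  have := gaussDet_pos_aux (φ := fun t => φ t - n * Real.pi) hx hy
    (fun t => (hφ t).sub_const _) hy0 hφ' (fun u => ?_) hxP hyP
    (fun u => by simp only [hφP]; ring) (t₀ := t₀) (by simp only [ht₀', sub_self]) ht₀.2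
    (by linarith) hst hts
  · have h5 : gaussDet x y (fun t => φ t - n * Real.pi) s t = gaussDet x y φ s t := by
      simp only [gaussDet, hsinn, hcosn]
      linear_combination ((x t * Real.sin (φ t) - y t * Real.cos (φ t)) * Real.sin (φ s)
        - (x s * Real.sin (φ s) - y s * Real.cos (φ s)) * Real.sin (φ t)) * hsq
    rwa [h5] at this
  · simp only [hsinn, hcosn]
    have := hW u
    have h6 : x' u * ((-1) ^ n * Real.sin (φ u)) ^ 2
        - y' u * ((-1) ^ n * Real.sin (φ u)) * ((-1) ^ n * Real.cos (φ u)) + y u * φ' u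
        = x' u * Real.sin (φ u) ^ 2 - y' u * Real.sin (φ u) * Real.cos (φ u) + y u * φ' u := by
      linear_combination (x' u * Real.sin (φ u) ^ 2 - y' u * Real.sin (φ u) * Real.cos (φ u)) * hsq
    rwa [h6]

namespace FramedLoop

variable {x y ψ σ k : ℝ → ℝ} {P : ℝ}

lemma continuous_re (h : FramedLoop x y ψ σ k P) : Continuous x :=
  continuous_iff_continuousAt.2 fun t => (h.hasDerivAt_re t).continuousAt

lemma continuous_im (h : FramedLoop x y ψ σ k P) : Continuous y :=
  continuous_iff_continuousAt.2 fun t => (h.hasDerivAt_im t).continuousAt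

lemma continuous_angle (h : FramedLoop x y ψ σ k P) : Continuous ψ :=
  continuous_iff_continuousAt.2 fun t => (h.hasDerivAt_angle t).continuousAt

lemma angle_deriv_pos (h : FramedLoop x y ψ σ k P) (t : ℝ) :
    0 < σ t * (k t - Real.cos (ψ t)) :=
  mul_pos (h.speed_pos t) (by linarith [h.one_lt_curvature t, Real.cos_le_one (ψ t)])

lemma strictMono_angle (h : FramedLoop x y ψ σ k P) : StrictMono ψ :=
  strictMono_of_hasDerivAt_pos h.hasDerivAt_angle h.angle_deriv_pos

lemma half_angle_add_period (h : FramedLoop x y ψ σ k P) (c t : ℝ) :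
    ψ (t + P) / 2 + c = ψ t / 2 + c + Real.pi := by
  rw [h.angle_add_period]; ring

/-- The endpoint of the inward normal ray moves monotonically. -/
lemma gaussDet_inward_pos (h : FramedLoop x y ψ σ k P) {s t : ℝ} (hst : s < t)
    (hts : t < s + P) : 0 < gaussDet x y (fun t => ψ t / 2 + 0) s t := by
  refine gaussDet_pos h.hasDerivAt_re h.hasDerivAt_im
    (fun t => ((h.hasDerivAt_angle t).div_const 2).add_const 0) h.im_pos
    (fun t => half_pos (h.angle_deriv_pos t)) (fun t => ?_) h.periodic_re h.periodic_im
    (h.half_angle_add_period 0) hst hts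
  have h1 : Real.cos (ψ t) = 2 * Real.cos (ψ t / 2) ^ 2 - 1 := by
    rw [← Real.cos_two_mul]; ring_nf
  have h2 : Real.sin (ψ t) = 2 * Real.sin (ψ t / 2) * Real.cos (ψ t / 2) := by
    rw [← Real.sin_two_mul]; ring_nf
  have h3 := Real.sin_sq_add_cos_sq (ψ t / 2)
  -- This is the value of the expression to be shown positive: the inward endpoint advances exactly
  -- because `k > 1`.
  have h4 : 0 < y t * σ t * (k t - 1) / 2 := by
    have := h.im_pos t
    have := h.speed_pos t
    have := sub_pos.2 (h.one_lt_curvature t)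
    positivity
  rw [add_zero]
  convert h4 using 1
  rw [h1, h2]
  linear_combination (-y t * σ t) * h3

/-- The endpoint of the outward normal ray moves monotonically. -/
lemma gaussDet_outward_pos (h : FramedLoop x y ψ σ k P) {s t : ℝ} (hst : s < t)
    (hts : t < s + P) : 0 < gaussDet x y (fun t => ψ t / 2 + Real.pi / 2) s t := by
  refine gaussDet_pos h.hasDerivAt_re h.hasDerivAt_im
    (fun t => ((h.hasDerivAt_angle t).div_const 2).add_const (Real.pi / 2)) h.im_pos
    (fun t => half_pos (h.angle_deriv_pos t)) (fun t => ?_) h.periodic_re h.periodic_im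
    (h.half_angle_add_period _) hst hts
  have h1 : Real.cos (ψ t) = 2 * Real.cos (ψ t / 2) ^ 2 - 1 := by
    rw [← Real.cos_two_mul]; ring_nf
  have h2 : Real.sin (ψ t) = 2 * Real.sin (ψ t / 2) * Real.cos (ψ t / 2) := by
    rw [← Real.sin_two_mul]; ring_nf
  have h3 := Real.sin_sq_add_cos_sq (ψ t / 2)
  have h4 : 0 < y t * σ t * (k t + 1) / 2 := by
    have := h.im_pos t
    have := h.speed_pos t
    have := h.one_lt_curvature t
    positivity
  rw [Real.sin_add_pi_div_two, Real.cos_add_pi_div_two]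
  convert h4 using 1
  rw [h1, h2]
  linear_combination (2 * y t * σ t * Real.cos (ψ t / 2) ^ 2) * h3

/-! ### Orthogonality relations and the test function -/

/-- Four linear relations satisfied by the deviation of the curvature from its mean. -/
lemma integral_mul_eq_zero (h : FramedLoop x y ψ σ k P) {C : ℝ}
    (hC : ∫ t in (0 : ℝ)..P, (k t - C) * σ t = 0) (A B D E p : ℝ) :
    ∫ t in p..p + P, (k t - C) * σ t * (A + B * (Real.sin (ψ t) / y t)
      + D * ((x t * Real.sin (ψ t) - y t * Real.cos (ψ t)) / y t)
      + E * (((x t ^ 2 - y t ^ 2) * Real.sin (ψ t) - 2 * x t * y t * Real.cos (ψ t)) / y t))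
      = 0 := by
  have hx := h.continuous_re
  have hy := h.continuous_im
  have hψ := h.continuous_angle
  have hk := h.continuous_curvature
  have hσ := h.continuous_speed
  have hy0 : ∀ t, y t ≠ 0 := fun t => (h.im_pos t).ne'
  -- A periodic primitive for the three Killing fields `1`, `z`, `z²`: the terms without `C` are
  -- `-⟨X, T⟩`, and those with `C` are `C` times primitives of `⟨X, N⟩ σ`.
  set H : ℝ → ℝ := fun t => (B * (C - Real.cos (ψ t))
    + D * (C * x t - (x t * Real.cos (ψ t) + y t * Real.sin (ψ t)))
    + E * (C * (x t ^ 2 + y t ^ 2)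
      - ((x t ^ 2 - y t ^ 2) * Real.cos (ψ t) + 2 * x t * y t * Real.sin (ψ t)))) / y t with hH
  set f : ℝ → ℝ := fun t => (k t - C) * σ t * (B * (Real.sin (ψ t) / y t)
      + D * ((x t * Real.sin (ψ t) - y t * Real.cos (ψ t)) / y t)
      + E * (((x t ^ 2 - y t ^ 2) * Real.sin (ψ t) - 2 * x t * y t * Real.cos (ψ t)) / y t))
    with hf
  have hfc : Continuous f := by fun_prop (disch := exact hy0)
  have hHd : ∀ t, HasDerivAt H (f t) t := by
    intro t
    have dx := h.hasDerivAt_re t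
    have dy := h.hasDerivAt_im t
    have dc := (h.hasDerivAt_angle t).cos
    have ds := (h.hasDerivAt_angle t).sin
    refine HasDerivAt.congr_deriv (((((dc.const_sub C).const_mul B).add
      (((dx.const_mul C).sub ((dx.mul dc).add (dy.mul ds))).const_mul D)).add
      (((((dx.pow 2).add (dy.pow 2)).const_mul C).sub
        ((((dx.pow 2).sub (dy.pow 2)).mul dc).add
          (((dx.const_mul 2).mul dy).mul ds))).const_mul E)).div dy (hy0 t)) ?_
    have h2 := hy0 t
    simp only [hf, Pi.add_apply, Pi.mul_apply, Pi.sub_apply, Pi.pow_apply]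
    field_simp
    ring
  have hHP : H (p + P) = H p := by
    simp only [hH, h.periodic_re p, h.periodic_im p, h.angle_add_period, Real.cos_add_two_pi,
      Real.sin_add_two_pi]
  have h1 : ∫ t in p..p + P, f t = 0 := by
    rw [intervalIntegral.integral_eq_sub_of_hasDerivAt (fun t _ => hHd t)
      (hfc.intervalIntegrable _ _), hHP, sub_self]
  have hper : Function.Periodic (fun t => (k t - C) * σ t) P := fun t => by
    simp only [h.periodic_curvature t, h.periodic_speed t]
  have h2 : ∫ t in p..p + P, A * ((k t - C) * σ t) = 0 := by
    rw [intervalIntegral.integral_const_mul, hper.intervalIntegral_add_eq p 0, zero_add, hC,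
      mul_zero]
  have h3 := intervalIntegral.integral_add (μ := volume) (hfc.intervalIntegrable p (p + P))
    (g := fun t => A * ((k t - C) * σ t)) (by apply Continuous.intervalIntegrable; fun_prop)
  rw [h1, h2, add_zero] at h3
  rw [← h3]
  refine intervalIntegral.integral_congr fun t _ => ?_
  simp only [hf]
  ring

/-- The function used to test the curvature deviation; it vanishes at `p` and `q` only. -/
noncomputable def testFunction (x y ψ : ℝ → ℝ) (p q t : ℝ) : ℝ :=
  gaussDet x y (fun t => ψ t / 2 + 0) p t * gaussDet x y (fun t => ψ t / 2 + Real.pi / 2) q t / y t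

lemma continuous_testFunction (h : FramedLoop x y ψ σ k P) (p q : ℝ) :
    Continuous (testFunction x y ψ p q) := by
  have hx := h.continuous_re
  have hy := h.continuous_im
  have hψ := h.continuous_angle
  have hy0 : ∀ t, y t ≠ 0 := fun t => (h.im_pos t).ne'
  unfold testFunction gaussDet
  fun_prop (disch := exact hy0)

lemma integral_mul_testFunction (h : FramedLoop x y ψ σ k P) {C : ℝ}
    (hC : ∫ t in (0 : ℝ)..P, (k t - C) * σ t = 0) (p q : ℝ) :
    ∫ t in p..p + P, (k t - C) * σ t * testFunction x y ψ p q t = 0 := by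
  -- `(A₁, S₁)` is the inward vector at `p` and `(A₂, S₂)` the outward vector at `q`. Expanding the
  -- two determinants and using half-angle formulas in `ψ t` gives the four coefficients.
  set S₁ := Real.sin (ψ p / 2)
  set A₁ := x p * Real.sin (ψ p / 2) - y p * Real.cos (ψ p / 2)
  set S₂ := Real.cos (ψ q / 2)
  set A₂ := x q * Real.cos (ψ q / 2) + y q * Real.sin (ψ q / 2)
  rw [← h.integral_mul_eq_zero hC ((S₁ * A₂ - A₁ * S₂) / 2) (A₁ * A₂ / 2)
    (-(S₁ * A₂ + A₁ * S₂) / 2) (S₁ * S₂ / 2) p]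
  refine intervalIntegral.integral_congr fun t _ => ?_
  have h1 : Real.cos (ψ t) = 2 * Real.cos (ψ t / 2) ^ 2 - 1 := by
    rw [← Real.cos_two_mul]; ring_nf
  have h2 : Real.sin (ψ t) = 2 * Real.sin (ψ t / 2) * Real.cos (ψ t / 2) := by
    rw [← Real.sin_two_mul]; ring_nf
  have h3 := Real.sin_sq_add_cos_sq (ψ t / 2)
  have hy0 := (h.im_pos t).ne'
  simp only [testFunction, gaussDet, Real.sin_add_pi_div_two, Real.cos_add_pi_div_two, add_zero]
  congr 1
  rw [h1, h2]
  simp only [S₁, A₁, S₂, A₂]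
  field_simp
  linear_combination (2 * y t * Real.cos (ψ q / 2) * (x t * Real.sin (ψ p / 2)
    - (x p * Real.sin (ψ p / 2) - y p * Real.cos (ψ p / 2)))) * h3

/-- The curvature deviation cannot have one sign on `[p, q]` and the other on `[q, p + P]`. -/
lemma eq_of_two_arcs (h : FramedLoop x y ψ σ k P) {C : ℝ}
    (hC : ∫ t in (0 : ℝ)..P, (k t - C) * σ t = 0) {p q ε : ℝ} (hε : ε ≠ 0) (hpq : p ≤ q)
    (hqp : q ≤ p + P) (h1 : ∀ t ∈ Set.Icc p q, 0 ≤ ε * (k t - C))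
    (h2 : ∀ t ∈ Set.Icc q (p + P), ε * (k t - C) ≤ 0) {t : ℝ} (ht : t ∈ Set.Ioo p (p + P))
    (htq : t ≠ q) : k t = C := by
  have hP := h.period_pos
  -- Before `q` the outward determinant is compared at `u + P`, which lies in `(q, q + P)`;
  -- returning by a period reverses its sign.
  have hle : ∀ u ∈ Set.Ioo p (p + P), u < q → testFunction x y ψ p q u < 0 := by
    intro u hu huq
    have a1 := h.gaussDet_inward_pos hu.1 hu.2
    have a2 := h.gaussDet_outward_pos (s := q) (t := u + P) (by linarith [hu.1]) (by linarith)
    rw [gaussDet_add_period h.periodic_re h.periodic_im (h.half_angle_add_period _)] at a2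
    exact div_neg_of_neg_of_pos (mul_neg_of_pos_of_neg a1 (by linarith)) (h.im_pos u)
  have hge : ∀ u ∈ Set.Ioo p (p + P), q < u → 0 < testFunction x y ψ p q u := by
    intro u hu huq
    exact div_pos (mul_pos (h.gaussDet_inward_pos hu.1 hu.2)
      (h.gaussDet_outward_pos huq (by linarith [hu.2]))) (h.im_pos u)
  have hq0 : testFunction x y ψ p q q = 0 := by
    rw [testFunction, gaussDet_self, mul_zero, zero_div]
  have hp0 : testFunction x y ψ p q (p + P) = 0 := by
    rw [testFunction, gaussDet_add_period h.periodic_re h.periodic_im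
      (h.half_angle_add_period _), gaussDet_self, neg_zero, zero_mul, zero_div]
  by_contra hne
  have hcont : Continuous fun u => -(ε * ((k u - C) * σ u * testFunction x y ψ p q u)) := by
    have := h.continuous_testFunction p q
    have := h.continuous_curvature
    have := h.continuous_speed
    fun_prop
  have hnonneg : ∀ u ∈ Set.Ioc p (p + P),
      0 ≤ -(ε * ((k u - C) * σ u * testFunction x y ψ p q u)) := by
    intro u hu
    rw [show -(ε * ((k u - C) * σ u * testFunction x y ψ p q u))
      = σ u * (-(ε * (k u - C) * testFunction x y ψ p q u)) by ring]
    refine mul_nonneg (h.speed_pos u).le ?_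
    rcases hu.2.eq_or_lt with rfl | hu2
    · rw [hp0, mul_zero, neg_zero]
    rcases lt_trichotomy u q with huq | rfl | huq
    · exact neg_nonneg.2 (mul_nonpos_of_nonneg_of_nonpos (h1 u ⟨hu.1.le, huq.le⟩)
        (hle u ⟨hu.1, hu2⟩ huq).le)
    · rw [hq0, mul_zero, neg_zero]
    · exact neg_nonneg.2 (mul_nonpos_of_nonpos_of_nonneg (h2 u ⟨huq.le, hu2.le⟩)
        (hge u ⟨hu.1, hu2⟩ huq).le)
  have htest : testFunction x y ψ p q t ≠ 0 := by
    rcases lt_or_gt_of_ne htq with h' | h'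
    · exact (hle t ht h').ne
    · exact (hge t ht h').ne'
  have hpos := intervalIntegral.integral_pos (by linarith : p < p + P) hcont.continuousOn hnonneg
    ⟨t, ⟨ht.1.le, ht.2.le⟩, (hnonneg t ⟨ht.1, ht.2.le⟩).lt_of_ne' (neg_ne_zero.2
      (mul_ne_zero hε (mul_ne_zero (mul_ne_zero (sub_ne_zero.2 hne) (h.speed_pos t).ne')
        htest)))⟩
  rw [intervalIntegral.integral_neg, intervalIntegral.integral_const_mul,
    h.integral_mul_testFunction hC, mul_zero, neg_zero] at hpos
  exact lt_irrefl _ hpos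

end FramedLoop

/-! ### Counting the zeros of the curvature deviation -/

lemma nonneg_or_nonpos_of_ne_zero {g : ℝ → ℝ} (hg : Continuous g) {a b : ℝ}
    (h : ∀ t ∈ Set.Ioo a b, g t ≠ 0) :
    (∀ t ∈ Set.Icc a b, 0 ≤ g t) ∨ ∀ t ∈ Set.Icc a b, g t ≤ 0 := by
  by_contra! hcon
  obtain ⟨⟨s, hs, hs'⟩, t, ht, ht'⟩ := hcon
  obtain ⟨r, hr, hr0⟩ := intermediate_value_uIcc (hg.continuousOn (s := Set.uIcc s t))
    (Set.mem_uIcc_of_le hs'.le ht'.le)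
  have hrs : r ≠ s := by rintro rfl; linarith
  have hrt : r ≠ t := by rintro rfl; linarith
  refine h r ?_ hr0
  rcases Set.mem_uIcc.1 hr with h1 | h1
  · exact ⟨hs.1.trans_lt (h1.1.lt_of_ne' hrs), (h1.2.lt_of_ne hrt).trans_le ht.2⟩
  · exact ⟨ht.1.trans_lt (h1.1.lt_of_ne' hrt), (h1.2.lt_of_ne hrs).trans_le hs.2⟩

/-- A set with at most two elements in an order is contained in an ordered pair. -/
lemma exists_subset_pair_of_encard_le_two {a b : ℝ} {Z : Set ℝ} (hZ : Z ⊆ Set.Ico a b)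
    (hab : a < b) (hcard : Z.encard ≤ 2) :
    ∃ z₁ ∈ Set.Ico a b, ∃ z₂ ∈ Set.Ico a b, z₁ ≤ z₂ ∧ Z ⊆ {z₁, z₂} := by
  have ha : a ∈ Set.Ico a b := ⟨le_rfl, hab⟩
  suffices ∃ z₁ ∈ Set.Ico a b, ∃ z₂ ∈ Set.Ico a b, Z ⊆ {z₁, z₂} by
    obtain ⟨z₁, h₁, z₂, h₂, h⟩ := this
    rcases le_total z₁ z₂ with hle | hle
    · exact ⟨z₁, h₁, z₂, h₂, hle, h⟩
    · exact ⟨z₂, h₂, z₁, h₁, hle, by rwa [Set.pair_comm]⟩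
  rcases hcard.lt_or_eq with hlt | heq
  · have : Z.encard ≤ 1 := ENat.lt_add_one_iff (n := 1) (by simp) |>.1 (by simpa [one_add_one_eq_two] using hlt)
    rcases Set.encard_le_one_iff_eq.1 this with rfl | ⟨z, rfl⟩
    · exact ⟨a, ha, a, ha, Set.empty_subset _⟩
    · exact ⟨z, hZ rfl, z, hZ rfl, by simp⟩
  · obtain ⟨z₁, z₂, -, rfl⟩ := Set.encard_eq_two.1 heq
    exact ⟨z₁, hZ (by simp), z₂, hZ (by simp), subset_rfl⟩

namespace FramedLoop

variable {x y ψ σ k : ℝ → ℝ} {P : ℝ}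

/-- Starting the period at a zero means that at most three zeros leave only three arcs to examine.
-/
lemma exists_curvature_eq (h : FramedLoop x y ψ σ k P) {C : ℝ}
    (hC : ∫ t in (0 : ℝ)..P, (k t - C) * σ t = 0) : ∃ t, k t = C := by
  by_contra! hne
  have hP := h.period_pos
  have hk := h.continuous_curvature
  have hσ := h.continuous_speed
  have hg : Continuous fun t => k t - C := by fun_prop
  rcases nonneg_or_nonpos_of_ne_zero hg (a := 0) (b := P) (fun t _ => sub_ne_zero.2 (hne t))
    with hs | hs
  · have := intervalIntegral.integral_pos hP (f := fun t => (k t - C) * σ t) (by fun_prop)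
      (fun t ht => mul_nonneg (hs t ⟨ht.1.le, ht.2⟩) (h.speed_pos t).le)
      ⟨0, ⟨le_rfl, hP.le⟩, mul_pos ((hs 0 ⟨le_rfl, hP.le⟩).lt_of_ne' (sub_ne_zero.2 (hne 0)))
        (h.speed_pos 0)⟩
    linarith
  · have := intervalIntegral.integral_pos hP (f := fun t => -((k t - C) * σ t)) (by fun_prop)
      (fun t ht => neg_nonneg.2
        (mul_nonpos_of_nonpos_of_nonneg (hs t ⟨ht.1.le, ht.2⟩) (h.speed_pos t).le))
      ⟨0, ⟨le_rfl, hP.le⟩, neg_pos.2 (mul_neg_of_neg_of_pos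
        ((hs 0 ⟨le_rfl, hP.le⟩).lt_of_ne (sub_ne_zero.2 (hne 0))) (h.speed_pos 0))⟩
    rw [intervalIntegral.integral_neg] at this
    linarith

/-- The curvature takes its mean value at least four times during a period. -/
theorem four_le_encard (h : FramedLoop x y ψ σ k P) {C : ℝ}
    (hC : ∫ t in (0 : ℝ)..P, (k t - C) * σ t = 0) :
    ∃ p, 4 ≤ {t ∈ Set.Ico p (p + P) | k t = C}.encard := by
  have hP := h.period_pos
  obtain ⟨p, hp⟩ := h.exists_curvature_eq hC
  refine ⟨p, ?_⟩
  by_contra! hlt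
  set Z := {t ∈ Set.Ico p (p + P) | k t = C} with hZ
  have hpZ : p ∈ Z := ⟨⟨le_rfl, by linarith⟩, hp⟩
  have hfin : Z.Finite := Set.finite_of_encard_le_coe (k := 4) hlt.le
  have hcard : (Z \ {p}).encard ≤ 2 := by
    have h1 := Set.encard_sdiff_singleton_add_one hpZ
    rw [← h1] at hlt
    have h2 : (Z \ {p}).encard + 1 ≤ 3 := ENat.lt_add_one_iff (n := 3) (by simp) |>.1 hlt
    exact (ENat.add_le_add_iff_right (by simp : (1 : ℕ∞) ≠ ⊤)).1 h2
  obtain ⟨z₁, hz₁, z₂, hz₂, hz, hsub⟩ := exists_subset_pair_of_encard_le_two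
    (fun t ht => ht.1.1 : Z \ {p} ⊆ Set.Ico p (p + P)) (by linarith) hcard
  have hne : ∀ t ∈ Set.Ioo p (p + P), t ≠ z₁ → t ≠ z₂ → k t - C ≠ 0 := by
    intro t ht h1 h2 h0
    rcases hsub ⟨⟨⟨ht.1.le, ht.2⟩, sub_eq_zero.1 h0⟩, ht.1.ne'⟩ with h3 | h3
    · exact h1 h3
    · exact h2 h3
  have hk := h.continuous_curvature
  have hg : Continuous fun t => k t - C := by fun_prop
  -- A two-arc sign pattern would make `k = C` on an interval minus one point, against the
  -- finiteness of `Z`.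
  have key : ∀ {a q ε : ℝ}, a ∈ Set.Ico p (p + P) → ε ≠ 0 → a ≤ q → q ≤ a + P →
      (∀ t ∈ Set.Icc a q, 0 ≤ ε * (k t - C)) →
      (∀ t ∈ Set.Icc q (a + P), ε * (k t - C) ≤ 0) → False := by
    intro a q ε ha hε haq hqa h1 h2
    refine ((Set.Ioo_infinite ha.2).sdiff (Set.finite_singleton q)) (hfin.subset ?_)
    rintro t ⟨ht, htq⟩
    exact ⟨⟨(ha.1.trans_lt ht.1).le, ht.2⟩,
      h.eq_of_two_arcs hC hε haq hqa h1 h2 ⟨ht.1, ht.2.trans_le (by linarith [ha.1])⟩ htq⟩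
  have hpp : p ∈ Set.Ico p (p + P) := ⟨le_rfl, by linarith⟩
  have arc₁ := nonneg_or_nonpos_of_ne_zero hg (a := p) (b := z₁) fun t ht =>
    hne t ⟨ht.1, ht.2.trans hz₁.2⟩ ht.2.ne (ht.2.trans_le hz).ne
  have arc₂ := nonneg_or_nonpos_of_ne_zero hg (a := z₁) (b := z₂) fun t ht =>
    hne t ⟨hz₁.1.trans_lt ht.1, ht.2.trans hz₂.2⟩ ht.1.ne' ht.2.ne
  have arc₃ := nonneg_or_nonpos_of_ne_zero hg (a := z₂) (b := p + P) fun t ht =>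
    hne t ⟨hz₂.1.trans_lt ht.1, ht.2⟩ (hz.trans_lt ht.1).ne' ht.1.ne'
  -- With `ε` making the first arc nonnegative, four patterns remain. In `+ - +` the outer arcs join
  -- across the period, so the base point moves to `z₁`. Weak signs suffice, which also allows
  -- degenerate arcs.
  have main : ∀ ε : ℝ, ε ≠ 0 → (∀ t ∈ Set.Icc p z₁, 0 ≤ ε * (k t - C)) →
      ((∀ t ∈ Set.Icc z₁ z₂, 0 ≤ ε * (k t - C)) ∨ ∀ t ∈ Set.Icc z₁ z₂, ε * (k t - C) ≤ 0) →
      ((∀ t ∈ Set.Icc z₂ (p + P), 0 ≤ ε * (k t - C)) ∨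
        ∀ t ∈ Set.Icc z₂ (p + P), ε * (k t - C) ≤ 0) → False := by
    intro ε hε h1 h2 h3
    rcases h2 with h2 | h2 <;> rcases h3 with h3 | h3
    -- The second arc shrinks to the point `p + P`, where the deviation is zero.
    · refine key (q := p + P) hpp hε (by linarith) le_rfl (fun t ht => ?_) fun t ht => ?_
      · rcases le_total t z₁ with h4 | h4
        · exact h1 t ⟨ht.1, h4⟩
        rcases le_total t z₂ with h5 | h5
        · exact h2 t ⟨h4, h5⟩
        · exact h3 t ⟨h5, ht.2⟩
      · rw [le_antisymm ht.2 ht.1, h.periodic_curvature, hp, sub_self, mul_zero]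
    · refine key (q := z₂) hpp hε hz₂.1 hz₂.2.le (fun t ht => ?_) h3
      rcases le_total t z₁ with h4 | h4
      · exact h1 t ⟨ht.1, h4⟩
      · exact h2 t ⟨h4, ht.2⟩
    · refine key (q := z₂) (ε := -ε) hz₁ (neg_ne_zero.2 hε) hz
        (by linarith [hz₂.2, hz₁.1]) (fun t ht => ?_) fun t ht => ?_
      · linarith [h2 t ht]
      · rcases le_total t (p + P) with h4 | h4
        · linarith [h3 t ⟨ht.1, h4⟩]
        · have h5 := h1 (t - P) ⟨by linarith, by linarith [ht.2]⟩
          rw [h.periodic_curvature.sub_eq] at h5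
          linarith
    · refine key (q := z₁) hpp hε hz₁.1 hz₁.2.le h1 fun t ht => ?_
      rcases le_total t z₂ with h4 | h4
      · exact h2 t ⟨ht.1, h4⟩
      · exact h3 t ⟨h4, ht.2⟩
  rcases arc₁ with h1 | h1
  · exact main 1 one_ne_zero (by simpa using h1) (by simpa using arc₂) (by simpa using arc₃)
  · exact main (-1) (by norm_num) (by simpa using h1) (by simpa using arc₂.symm)
      (by simpa using arc₃.symm)

end FramedLoop

/-! ### The region between two graphs and its hyperbolic area -/

/-- A curve that is injective in its first coordinate is the graph of a continuous function. -/
lemma exists_continuous_graph {f g : ℝ → ℝ} (hf : Continuous f) (hg : Continuous g) {a b : ℝ}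
    (hinj : Set.InjOn f (Set.Icc a b)) :
    ∃ G : ℝ → ℝ, Continuous G ∧ ∀ t ∈ Set.Icc a b, G (f t) = g t := by
  have he : Topology.IsClosedEmbedding fun t : Set.Icc a b => f t :=
    (hf.comp continuous_subtype_val).isClosedEmbedding hinj.injective
  obtain ⟨G, hG⟩ := ContinuousMap.exists_extension he
    (⟨fun t => g t, hg.comp continuous_subtype_val⟩ : C(Set.Icc a b, ℝ))
  exact ⟨G, G.continuous, fun t ht => DFunLike.congr_fun hG ⟨t, ht⟩⟩

/-- A vertical hyperbolic ray in an open set makes the connected component unbounded. -/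
lemma not_isBounded_connectedComponentIn {U : Set ℍ} {z : ℍ} {S : Set ℝ} (hS : IsPreconnected S)
    (h0 : (0 : ℝ) ∈ S) (hunb : ∀ C, ∃ r ∈ S, C < |r|)
    (hU : ∀ r ∈ S, ∀ w : ℍ, w.re = z.re → w.im = z.im * Real.exp r → w ∈ U) :
    ¬ Bornology.IsBounded (connectedComponentIn U z) := by
  intro hb
  let ray : ℝ → ℍ := fun r =>
    ⟨⟨z.re, z.im * Real.exp r⟩, mul_pos z.im_pos (Real.exp_pos r)⟩
  have hray : Continuous ray := by
    rw [isEmbedding_coe.continuous_iff]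
    have : (UpperHalfPlane.coe ∘ ray) =
        fun r => ((z.re : ℂ) + ((z.im * Real.exp r : ℝ) : ℂ) * Complex.I) := by
      funext r
      exact (Complex.re_add_im (ray r : ℂ)).symm
    rw [this]
    fun_prop
  have hz : ray 0 = z := UpperHalfPlane.ext_re_im rfl
    (by change z.im * Real.exp 0 = z.im; rw [Real.exp_zero, mul_one])
  have hsub : ray '' S ⊆ connectedComponentIn U z :=
    (hS.image ray hray.continuousOn).subset_connectedComponentIn ⟨0, h0, hz⟩
      (by rintro _ ⟨r, hr, rfl⟩; exact hU r hr _ rfl rfl)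
  obtain ⟨C, hC⟩ := hb.subset_closedBall z
  obtain ⟨r, hr, hCr⟩ := hunb C
  have h1 : dist (ray r) z ≤ C := hC (hsub ⟨r, hr, rfl⟩)
  -- Hyperbolic distance dominates the difference of `log im`, which is `|r|` along the ray.
  have h2 := (dist_log_im_le (ray r) z).trans h1
  have h3 : Real.log (ray r).im = Real.log z.im + r := by
    change Real.log (z.im * Real.exp r) = _
    rw [Real.log_mul z.im_pos.ne' (Real.exp_pos r).ne', Real.log_exp]
  rw [h3, Real.dist_eq, add_sub_cancel_left] at h2
  linarith

/-- The inside of a closed curve which is the union of two graphs over an interval. -/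
lemma inside_eq_of_graphs {γ : ℝ → ℍ} {a b : ℝ} {g₁ g₂ : ℝ → ℝ} (hg₁ : Continuous g₁)
    (hg₂ : Continuous g₂) (hab : a < b) (hga : g₁ a = g₂ a) (hgb : g₁ b = g₂ b)
    (hlt : ∀ t ∈ Set.Ioo a b, g₁ t < g₂ t) (hpos : ∀ t ∈ Set.Icc a b, 0 < g₁ t)
    (hrange : ∀ z : ℍ, z ∈ Set.range γ ↔
      z.re ∈ Set.Icc a b ∧ (z.im = g₁ z.re ∨ z.im = g₂ z.re)) :
    inside γ = {z | z.re ∈ Set.Ioo a b ∧ g₁ z.re < z.im ∧ z.im < g₂ z.re} := by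
  have hle : ∀ t ∈ Set.Icc a b, g₁ t ≤ g₂ t := by
    intro t ht
    rcases ht.1.eq_or_lt with rfl | h1
    · exact hga.le
    rcases ht.2.eq_or_lt with rfl | h2
    · exact hgb.le
    exact (hlt t ⟨h1, h2⟩).le
  set D : Set ℍ := {z | z.re ∈ Set.Ioo a b ∧ g₁ z.re < z.im ∧ z.im < g₂ z.re} with hD
  have hre := UpperHalfPlane.continuous_re
  have him := UpperHalfPlane.continuous_im
  have hDopen : IsOpen D := (isOpen_Ioo.preimage hre).inter
    ((isOpen_lt (hg₁.comp hre) him).inter (isOpen_lt him (hg₂.comp hre)))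
  set K : Set ℍ := {z | z.re ∈ Set.Icc a b ∧ g₁ z.re ≤ z.im ∧ z.im ≤ g₂ z.re} with hK
  have hKclosed : IsClosed K := (isClosed_Icc.preimage hre).inter
    ((isClosed_le (hg₁.comp hre) him).inter (isClosed_le him (hg₂.comp hre)))
  have hDK : D ⊆ K := fun z hz =>
    ⟨Set.Ioo_subset_Icc_self hz.1, hz.2.1.le, hz.2.2.le⟩
  have hKD : ∀ z ∈ K, z ∉ Set.range γ → z ∈ D := by
    intro z hz hzr
    rw [hrange] at hzr
    push Not at hzr
    obtain ⟨h1, h2⟩ := hzr hz.1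
    have h3 := hz.2.1.lt_of_ne' h1
    have h4 := hz.2.2.lt_of_ne h2
    refine ⟨⟨hz.1.1.lt_of_ne ?_, hz.1.2.lt_of_ne ?_⟩, h3, h4⟩
    · intro h; rw [← h] at h3 h4; linarith
    · intro h; rw [h] at h3 h4; linarith
  have hDr : ∀ z ∈ D, z ∉ Set.range γ := by
    intro z hz hzr
    rcases ((hrange z).1 hzr).2 with h | h
    · exact hz.2.1.ne' h
    · exact hz.2.2.ne h
  have hKbdd : Bornology.IsBounded K := by
    obtain ⟨t₁, ht₁, hm⟩ := isCompact_Icc.exists_isMinOn (Set.nonempty_Icc.2 hab.le)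
      hg₁.continuousOn
    obtain ⟨t₂, -, hM⟩ := isCompact_Icc.exists_isMaxOn (Set.nonempty_Icc.2 hab.le)
      hg₂.continuousOn
    have hcomp : IsCompact {z : ℍ | z.re ∈ Set.Icc a b ∧ z.im ∈ Set.Icc (g₁ t₁) (g₂ t₂)} := by
      rw [isEmbedding_coe.isCompact_iff]
      convert (isCompact_Icc (a := a) (b := b)).reProdIm
        (isCompact_Icc (a := g₁ t₁) (b := g₂ t₂)) using 1
      ext w
      constructor
      · rintro ⟨z, hz, rfl⟩
        exact hz
      · intro hw
        exact ⟨⟨w, (hpos t₁ ht₁).trans_le hw.2.1⟩, hw, rfl⟩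
    exact hcomp.isBounded.subset fun z hz =>
      ⟨hz.1, (hm hz.1).trans hz.2.1, hz.2.2.trans (hM hz.1)⟩
  ext z
  constructor
  · rintro ⟨hzr, hzb⟩
    by_contra hzD
    have hzK : z ∉ K := fun h => hzD (hKD z h hzr)
    have hup : (∀ w : ℍ, w.re = z.re → z.im ≤ w.im → w ∉ Set.range γ) → False := by
      intro hw
      refine not_isBounded_connectedComponentIn (S := Set.Ici 0) isPreconnected_Ici
        (Set.mem_Ici.2 le_rfl) (fun C => ⟨|C| + 1, ?_, ?_⟩) (fun r hr w h1 h2 => hw w h1 ?_) hzb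
      · exact Set.mem_Ici.2 (by positivity)
      · rw [abs_of_nonneg (by positivity)]; linarith [le_abs_self C]
      · rw [h2]
        exact le_mul_of_one_le_right z.im_pos.le (Real.one_le_exp hr)
    have hdown : (∀ w : ℍ, w.re = z.re → w.im ≤ z.im → w ∉ Set.range γ) → False := by
      intro hw
      refine not_isBounded_connectedComponentIn (S := Set.Iic 0) isPreconnected_Iic
        (Set.mem_Iic.2 le_rfl) (fun C => ⟨-(|C| + 1), ?_, ?_⟩)
        (fun r hr w h1 h2 => hw w h1 ?_) hzb
      · exact Set.mem_Iic.2 (neg_nonpos.2 (by positivity))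
      · rw [abs_neg, abs_of_nonneg (by positivity)]; linarith [le_abs_self C]
      · rw [h2]
        exact mul_le_of_le_one_right z.im_pos.le (Real.exp_le_one_iff.2 hr)
    -- A point below the lower graph escapes downward to the ideal boundary; every other point
    -- outside `K` escapes upward.
    by_cases hz : z.re ∈ Set.Icc a b
    · have hz2 := hle _ hz
      rcases lt_or_ge z.im (g₁ z.re) with h1 | h1
      · refine hdown fun w hw1 hw2 hwr => ?_
        rcases ((hrange w).1 hwr).2 with h | h <;> rw [hw1] at h <;> linarith
      · have h2 : g₂ z.re < z.im := not_le.1 fun h2 => hzK ⟨hz, h1, h2⟩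
        refine hup fun w hw1 hw2 hwr => ?_
        rcases ((hrange w).1 hwr).2 with h | h <;> rw [hw1] at h <;> linarith
    · exact hup fun w hw1 _ hwr => hz (hw1 ▸ ((hrange w).1 hwr).1)
  · intro hz
    have hzr := hDr z hz
    refine ⟨hzr, hKbdd.subset (Set.Subset.trans ?_ hDK)⟩
    -- Off the curve, `D` and the complement of `K` are disjoint open sets covering everything, so a
    -- component meeting `D` stays in `D`.
    refine isPreconnected_connectedComponentIn.subset_left_of_subset_union hDopen
      hKclosed.isOpen_compl ?_ ?_ ⟨z, mem_connectedComponentIn hzr, hz⟩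
    · exact Set.disjoint_compl_right_iff_subset.2 hDK
    · intro w hw
      by_cases hwK : w ∈ K
      · exact Or.inl (hKD w hwK (connectedComponentIn_subset _ _ hw))
      · exact Or.inr hwK

/-- The inner integral for the area; the integrand has the form of the density in
`volume_eq_lintegral`. -/
lemma lintegral_one_div_sq {a b : ℝ} (ha : 0 < a) (hab : a ≤ b) :
    ∫⁻ t in Set.Ioo a b, (((1 / ‖t‖₊) ^ 2 : NNReal) : ENNReal)
      = ENNReal.ofReal (1 / a - 1 / b) := by
  have hd : ∀ t ∈ Set.uIcc a b, HasDerivAt (fun t : ℝ => -(1 / t)) (1 / t ^ 2) t := by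
    intro t ht
    rw [Set.uIcc_of_le hab] at ht
    have : t ≠ 0 := (ha.trans_le ht.1).ne'
    have h := (hasDerivAt_inv this).neg
    rw [neg_neg] at h
    simp only [one_div]
    exact h
  have hc : ContinuousOn (fun t : ℝ => 1 / t ^ 2) (Set.uIcc a b) := by
    refine continuousOn_const.div (by fun_prop) fun t ht => ?_
    rw [Set.uIcc_of_le hab] at ht
    exact pow_ne_zero 2 (ha.trans_le ht.1).ne'
  have hi := hc.intervalIntegrable (μ := volume)
  have h1 := intervalIntegral.integral_eq_sub_of_hasDerivAt hd hi
  rw [intervalIntegral.integral_of_le hab] at h1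
  rw [intervalIntegrable_iff_integrableOn_Ioc_of_le hab] at hi
  rw [setLIntegral_congr Ioo_ae_eq_Ioc, show 1 / a - 1 / b = -(1 / b) - -(1 / a) by ring, ← h1,
    ofReal_integral_eq_lintegral_ofReal hi (ae_of_all _ fun t => by positivity)]
  refine lintegral_congr fun t => ?_
  rw [ENNReal.ofReal, Real.toNNReal_of_nonneg (by positivity)]
  congr 1
  ext
  simp [one_div]

/-- The hyperbolic area of the region between two graphs. -/
lemma volume_region_between_graphs {a b : ℝ} {g₁ g₂ : ℝ → ℝ} (hg₁ : Continuous g₁)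
    (hg₂ : Continuous g₂) (hab : a < b) (hlt : ∀ t ∈ Set.Ioo a b, g₁ t < g₂ t)
    (hpos : ∀ t ∈ Set.Icc a b, 0 < g₁ t) (hpos₂ : ∀ t ∈ Set.Icc a b, 0 < g₂ t) :
    (volume {z : ℍ | z.re ∈ Set.Ioo a b ∧ g₁ z.re < z.im ∧ z.im < g₂ z.re}).toReal
      = ∫ t in a..b, (1 / g₁ t - 1 / g₂ t) := by
  set D := {z : ℍ | z.re ∈ Set.Ioo a b ∧ g₁ z.re < z.im ∧ z.im < g₂ z.re} with hD
  set R := regionBetween g₁ g₂ (Set.Ioo a b) with hR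
  have hRm : MeasurableSet R :=
    measurableSet_regionBetween hg₁.measurable hg₂.measurable measurableSet_Ioo
  have himage : UpperHalfPlane.coe '' D = Complex.measurableEquivRealProd ⁻¹' R := by
    ext w
    constructor
    · rintro ⟨z, hz, rfl⟩
      exact hz
    · intro hw
      exact ⟨⟨w, (hpos _ (Set.Ioo_subset_Icc_self hw.1)).trans hw.2.1⟩, hw, rfl⟩
  have hmeas : Measurable fun p : ℝ × ℝ => (((1 / ‖p.2‖₊) ^ 2 : NNReal) : ENNReal) := by
    fun_prop
  have hvol : volume D = ∫⁻ t in Set.Ioo a b, ENNReal.ofReal (1 / g₁ t - 1 / g₂ t) := by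
    rw [volume_eq_lintegral, himage]
    have h1 := Complex.volume_preserving_equiv_real_prod.setLIntegral_comp_preimage hRm hmeas
    refine (Eq.trans ?_ h1).trans ?_
    · rfl
    rw [← lintegral_indicator hRm, Measure.volume_eq_prod,
      lintegral_prod _ (hmeas.indicator hRm).aemeasurable, ← lintegral_indicator measurableSet_Ioo]
    refine lintegral_congr fun t => ?_
    by_cases ht : t ∈ Set.Ioo a b
    · rw [Set.indicator_of_mem ht, ← lintegral_one_div_sq (hpos t (Set.Ioo_subset_Icc_self ht))
        (hlt t ht).le, ← lintegral_indicator measurableSet_Ioo]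
      refine lintegral_congr fun u => ?_
      by_cases hu : u ∈ Set.Ioo (g₁ t) (g₂ t)
      · rw [Set.indicator_of_mem hu, Set.indicator_of_mem (show (t, u) ∈ R from ⟨ht, hu⟩)]
      · rw [Set.indicator_of_notMem hu, Set.indicator_of_notMem fun h : (t, u) ∈ R => hu h.2]
    · rw [Set.indicator_of_notMem ht]
      refine (lintegral_congr fun u => ?_).trans lintegral_zero
      exact Set.indicator_of_notMem (fun h : (t, u) ∈ R => ht h.1) _
  have hc : ContinuousOn (fun t => 1 / g₁ t - 1 / g₂ t) (Set.uIcc a b) := by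
    rw [Set.uIcc_of_le hab.le]
    exact (continuousOn_const.div hg₁.continuousOn fun t ht => (hpos t ht).ne').sub
      (continuousOn_const.div hg₂.continuousOn fun t ht => (hpos₂ t ht).ne')
  have hi := hc.intervalIntegrable (μ := volume)
  rw [intervalIntegrable_iff_integrableOn_Ioo_of_le hab.le] at hi
  have hnn : ∀ᵐ t ∂(volume.restrict (Set.Ioo a b)), 0 ≤ 1 / g₁ t - 1 / g₂ t := by
    refine (ae_restrict_iff' measurableSet_Ioo).2 (ae_of_all _ fun t ht => ?_)
    have h1 := hpos t (Set.Ioo_subset_Icc_self ht)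
    exact sub_nonneg.2 (one_div_le_one_div_of_le h1 (hlt t ht).le)
  rw [hvol, ← ofReal_integral_eq_lintegral_ofReal hi hnn,
    ENNReal.toReal_ofReal (integral_nonneg_of_ae hnn), intervalIntegral.integral_of_le hab.le,
    integral_Ioc_eq_integral_Ioo]


/-! ### Global convexity and the Gauss–Bonnet formula -/

/-- A function that first increases and then decreases between two zeros is positive. -/
lemma pos_of_strictMonoOn_of_strictAntiOn {f : ℝ → ℝ} {a b c t : ℝ}
    (h1 : StrictMonoOn f (Set.Icc a b)) (h2 : StrictAntiOn f (Set.Icc b c)) (ha : f a = 0)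
    (hc : f c = 0) (ht : t ∈ Set.Ioo a c) : 0 < f t := by
  rcases le_total t b with h | h
  · rw [← ha]
    exact h1 ⟨le_rfl, ht.1.le.trans h⟩ ⟨ht.1.le, h⟩ ht.1
  · rw [← hc]
    exact h2 ⟨h, ht.2.le⟩ ⟨h.trans ht.2.le, le_rfl⟩ ht.2

namespace FramedLoop

variable {x y ψ σ k : ℝ → ℝ} {P : ℝ}

/-- `ψ` differs from `2πt / P` by a periodic function, so its values at the multiples of `P` are
unbounded in both directions. -/
lemma exists_angle_eq (h : FramedLoop x y ψ σ k P) (θ : ℝ) : ∃ t, ψ t = θ := by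
  have hP := h.period_pos
  have hpi := Real.two_pi_pos
  have hper : Function.Periodic (fun t => ψ t - 2 * Real.pi * (t / P)) P := fun t => by
    simp only [h.angle_add_period, add_div, div_self hP.ne']
    ring
  have hn : ∀ n : ℤ, ψ (n * P) = ψ 0 + n * (2 * Real.pi) := by
    intro n
    have := hper.int_mul n 0
    simp only [zero_add, mul_div_assoc, div_self hP.ne', zero_div] at this
    linarith
  have h1 := (le_div_iff₀ hpi).1 (Int.floor_le ((θ - ψ 0) / (2 * Real.pi)))
  have h2 := (div_lt_iff₀ hpi).1 (Int.lt_floor_add_one ((θ - ψ 0) / (2 * Real.pi)))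
  set n := ⌊(θ - ψ 0) / (2 * Real.pi)⌋
  have h3 := hn n
  have h4 := hn (n + 1)
  push_cast at h4
  obtain ⟨t, -, ht⟩ := intermediate_value_Icc (f := ψ)
    (by nlinarith : (n : ℝ) * P ≤ (n + 1) * P) h.continuous_angle.continuousOn
    (show θ ∈ Set.Icc _ _ from ⟨by linarith, by linarith⟩)
  exact ⟨t, ht⟩

/-- A framed loop lies strictly to the left of each of its tangent lines. -/
lemma tangent_height_pos (h : FramedLoop x y ψ σ k P) {s t : ℝ} (ht : t ∈ Set.Ioo s (s + P)) :
    0 < (y t - y s) * Real.cos (ψ s) - (x t - x s) * Real.sin (ψ s) := by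
  have hpi := Real.pi_pos
  have hd : ∀ u, HasDerivAt
      (fun u => (y u - y s) * Real.cos (ψ s) - (x u - x s) * Real.sin (ψ s))
      (y u * σ u * Real.sin (ψ u - ψ s)) u := by
    intro u
    refine ((((h.hasDerivAt_im u).sub_const _).mul_const _).sub
      (((h.hasDerivAt_re u).sub_const _).mul_const _)).congr_deriv ?_
    rw [Real.sin_sub]
    ring
  have hw : ∀ u, 0 < y u * σ u := fun u => mul_pos (h.im_pos u) (h.speed_pos u)
  -- At `m` the tangent is antiparallel to the one at `s`: the height above the tangent line rises
  -- up to `m` and then falls back to zero at `s + P`.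
  obtain ⟨m, hm⟩ := h.exists_angle_eq (ψ s + Real.pi)
  refine pos_of_strictMonoOn_of_strictAntiOn (b := m) (c := s + P)
    (f := fun u => (y u - y s) * Real.cos (ψ s) - (x u - x s) * Real.sin (ψ s))
    (strictMonoOn_of_deriv_pos (convex_Icc _ _)
      (fun u _ => (hd u).continuousAt.continuousWithinAt) fun u hu => ?_)
    (strictAntiOn_of_deriv_neg (convex_Icc _ _)
      (fun u _ => (hd u).continuousAt.continuousWithinAt) fun u hu => ?_) (by simp) ?_ ht
  · rw [interior_Icc] at hu
    have h1 := h.strictMono_angle hu.1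
    have h2 := h.strictMono_angle hu.2
    rw [(hd u).deriv]
    exact mul_pos (hw u) (Real.sin_pos_of_pos_of_lt_pi (by linarith) (by linarith))
  · rw [interior_Icc] at hu
    have h1 := h.strictMono_angle hu.1
    have h2 := h.strictMono_angle hu.2
    rw [h.angle_add_period] at h2
    rw [(hd u).deriv]
    refine mul_neg_of_pos_of_neg (hw u) ?_
    rw [← Real.sin_sub_two_pi]
    exact Real.sin_neg_of_neg_of_neg_pi_lt (by linarith) (by linarith)
  · simp [h.periodic_re s, h.periodic_im s]

/-- The area form `dx dy / y²` of the inside is `∮ dx / y`. -/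
lemma area_eq_integral {γ : ℝ → ℍ}
    (h : FramedLoop (fun t => (γ t).re) (fun t => (γ t).im) ψ σ k P)
    (hγ : Function.Periodic γ P) :
    ∃ t₀, area γ = ∫ t in t₀..t₀ + P, σ t * Real.cos (ψ t) := by
  have hP := h.period_pos
  have hpi := Real.pi_pos
  have hψ := h.continuous_angle
  have hσ := h.continuous_speed
  have hmono := h.strictMono_angle
  have hx : Continuous fun t => (γ t).re := h.continuous_re
  have hy : Continuous fun t => (γ t).im := h.continuous_im
  have hw : ∀ u, 0 < (γ u).im * σ u := fun u => mul_pos (h.im_pos u) (h.speed_pos u)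
  -- The vertical tangents mark the leftmost point `t₀` and the rightmost point `t₁`, which separate
  -- the lower arc from the upper one.
  obtain ⟨t₀, ht₀⟩ := h.exists_angle_eq (-(Real.pi / 2))
  obtain ⟨t₁, ht₁⟩ := h.exists_angle_eq (Real.pi / 2)
  have ht₂ : ψ (t₀ + P) = Real.pi + Real.pi / 2 := by rw [h.angle_add_period, ht₀]; ring
  have h01 : t₀ < t₁ := hmono.lt_iff_lt.1 (by rw [ht₀, ht₁]; linarith)
  have h12 : t₁ < t₀ + P := hmono.lt_iff_lt.1 (by rw [ht₁, ht₂]; linarith)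
  have hcos : ∀ u ∈ Set.Ioo t₀ t₁, 0 < Real.cos (ψ u) := by
    intro u hu
    have h1 := hmono hu.1
    have h2 := hmono hu.2
    exact Real.cos_pos_of_mem_Ioo ⟨by linarith, by linarith⟩
  have hxm : StrictMonoOn (fun t => (γ t).re) (Set.Icc t₀ t₁) := by
    refine strictMonoOn_of_deriv_pos (convex_Icc _ _) hx.continuousOn fun u hu => ?_
    rw [interior_Icc] at hu
    rw [(h.hasDerivAt_re u).deriv]
    exact mul_pos (hw u) (hcos u hu)
  have hxa : StrictAntiOn (fun t => (γ t).re) (Set.Icc t₁ (t₀ + P)) := by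
    refine strictAntiOn_of_deriv_neg (convex_Icc _ _) hx.continuousOn fun u hu => ?_
    rw [interior_Icc] at hu
    rw [(h.hasDerivAt_re u).deriv]
    have h1 := hmono hu.1
    have h2 := hmono hu.2
    exact mul_neg_of_pos_of_neg (hw u)
      (Real.cos_neg_of_pi_div_two_lt_of_lt (by linarith) (by linarith))
  obtain ⟨g₁, hg₁, hg₁'⟩ := exists_continuous_graph hx hy hxm.injOn
  obtain ⟨g₂, hg₂, hg₂'⟩ := exists_continuous_graph hx hy hxa.injOn
  set a := (γ t₀).re with ha
  set b := (γ t₁).re with hb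
  have haP : (γ (t₀ + P)).re = a := by rw [hγ t₀]
  have hab : a < b := hxm ⟨le_rfl, h01.le⟩ ⟨h01.le, le_rfl⟩ h01
  have hlow : ∀ X ∈ Set.Icc a b, ∃ t ∈ Set.Icc t₀ t₁, (γ t).re = X := fun X hX =>
    intermediate_value_Icc h01.le hx.continuousOn hX
  have hupp : ∀ X ∈ Set.Icc a b, ∃ t ∈ Set.Icc t₁ (t₀ + P), (γ t).re = X := fun X hX =>
    intermediate_value_Icc' h12.le hx.continuousOn (by rwa [haP])
  have hlt : ∀ X ∈ Set.Ioo a b, g₁ X < g₂ X := by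
    intro X hX
    obtain ⟨s, hs, rfl⟩ := hlow X (Set.Ioo_subset_Icc_self hX)
    obtain ⟨u, hu, hus⟩ := hupp _ (Set.Ioo_subset_Icc_self hX)
    have hs1 : s ∈ Set.Ioo t₀ t₁ := by
      refine ⟨hs.1.lt_of_ne ?_, hs.2.lt_of_ne ?_⟩
      · rintro rfl; exact lt_irrefl _ hX.1
      · rintro rfl; exact lt_irrefl _ hX.2
    -- The tangent at the lower point has `cos ψ > 0`, so lying to its left on the same vertical
    -- means lying above.
    have h1 := h.tangent_height_pos (s := s) (t := u)
      ⟨hs1.2.trans_le hu.1, by linarith [hu.2, hs1.1]⟩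
    rw [hus, sub_self, zero_mul, sub_zero] at h1
    have h2 := pos_of_mul_pos_left h1 (hcos s hs1).le
    rw [hg₁' s hs, ← hus, hg₂' u hu]
    linarith
  have hpos : ∀ X ∈ Set.Icc a b, 0 < g₁ X := by
    intro X hX
    obtain ⟨s, hs, rfl⟩ := hlow X hX
    rw [hg₁' s hs]
    exact h.im_pos s
  have hpos₂ : ∀ X ∈ Set.Icc a b, 0 < g₂ X := by
    intro X hX
    obtain ⟨s, hs, rfl⟩ := hupp X hX
    rw [hg₂' s hs]
    exact h.im_pos s
  have hga : g₁ a = g₂ a := by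
    rw [ha, hg₁' t₀ ⟨le_rfl, h01.le⟩, ← hγ t₀, hg₂' (t₀ + P) ⟨h12.le, le_rfl⟩]
  have hgb : g₁ b = g₂ b := by
    rw [hb, hg₁' t₁ ⟨h01.le, le_rfl⟩, hg₂' t₁ ⟨le_rfl, h12.le⟩]
  have hrange : ∀ z : ℍ, z ∈ Set.range γ ↔
      z.re ∈ Set.Icc a b ∧ (z.im = g₁ z.re ∨ z.im = g₂ z.re) := by
    intro z
    constructor
    · rintro ⟨t, rfl⟩
      obtain ⟨s, hs, hst⟩ := hγ.exists_mem_Ico hP t t₀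
      rw [hst]
      rcases le_total s t₁ with h1 | h1
      · exact ⟨⟨hxm.monotoneOn ⟨le_rfl, h01.le⟩ ⟨hs.1, h1⟩ hs.1,
          hxm.monotoneOn ⟨hs.1, h1⟩ ⟨h01.le, le_rfl⟩ h1⟩, Or.inl (hg₁' s ⟨hs.1, h1⟩).symm⟩
      · refine ⟨⟨?_, hxa.antitoneOn ⟨le_rfl, h12.le⟩ ⟨h1, hs.2.le⟩ h1⟩,
          Or.inr (hg₂' s ⟨h1, hs.2.le⟩).symm⟩
        rw [← haP]
        exact hxa.antitoneOn ⟨h1, hs.2.le⟩ ⟨h12.le, le_rfl⟩ hs.2.le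
    · rintro ⟨hz, hz' | hz'⟩
      · obtain ⟨s, hs, hsz⟩ := hlow _ hz
        rw [← hsz, hg₁' s hs] at hz'
        exact ⟨s, UpperHalfPlane.ext_re_im hsz hz'.symm⟩
      · obtain ⟨s, hs, hsz⟩ := hupp _ hz
        rw [← hsz, hg₂' s hs] at hz'
        exact ⟨s, UpperHalfPlane.ext_re_im hsz hz'.symm⟩
  -- The substitution `X = x t` turns `σ cos ψ dt` into `dX / y`; on the upper arc it runs from
  -- right to left, which supplies the minus sign in the area.
  have hsubst : ∀ {c d : ℝ} {g : ℝ → ℝ}, c ≤ d → Continuous g →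
      (∀ t ∈ Set.Icc c d, g (γ t).re = (γ t).im) →
      ∫ t in c..d, σ t * Real.cos (ψ t) = ∫ X in (γ c).re..(γ d).re, 1 / g X := by
    intro c d g hcd hg hgt
    rw [← intervalIntegral.integral_comp_mul_deriv' (fun t _ => h.hasDerivAt_re t)
      (by fun_prop) (g := fun X => 1 / g X)]
    · refine intervalIntegral.integral_congr fun t ht => ?_
      rw [Set.uIcc_of_le hcd] at ht
      have := (h.im_pos t).ne'
      simp only [Function.comp_apply, hgt t ht]
      field_simp
    · refine continuousOn_const.div hg.continuousOn ?_
      rintro _ ⟨t, ht, rfl⟩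
      rw [Set.uIcc_of_le hcd] at ht
      simp only [hgt t ht]
      exact (h.im_pos t).ne'
  refine ⟨t₀, ?_⟩
  have hi₁ : IntervalIntegrable (fun X => 1 / g₁ X) volume a b := by
    refine ContinuousOn.intervalIntegrable (continuousOn_const.div hg₁.continuousOn ?_)
    rw [Set.uIcc_of_le hab.le]
    exact fun X hX => (hpos X hX).ne'
  have hi₂ : IntervalIntegrable (fun X => 1 / g₂ X) volume a b := by
    refine ContinuousOn.intervalIntegrable (continuousOn_const.div hg₂.continuousOn ?_)
    rw [Set.uIcc_of_le hab.le]
    exact fun X hX => (hpos₂ X hX).ne'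
  have hc : Continuous fun t => σ t * Real.cos (ψ t) := by fun_prop
  rw [area, inside_eq_of_graphs hg₁ hg₂ hab hga hgb hlt hpos hrange,
    volume_region_between_graphs hg₁ hg₂ hab hlt hpos hpos₂,
    ← intervalIntegral.integral_add_adjacent_intervals (hc.intervalIntegrable t₀ t₁)
      (hc.intervalIntegrable t₁ (t₀ + P)), hsubst h01.le hg₁ hg₁', hsubst h12.le hg₂ hg₂', haP,
    intervalIntegral.integral_sub hi₁ hi₂, intervalIntegral.integral_symm a b, sub_eq_add_neg]

/-- The Gauss–Bonnet formula. -/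
theorem integral_curvature {γ : ℝ → ℍ}
    (h : FramedLoop (fun t => (γ t).re) (fun t => (γ t).im) ψ σ k P)
    (hγ : Function.Periodic γ P) :
    ∫ t in (0 : ℝ)..P, k t * σ t = 2 * Real.pi + area γ := by
  obtain ⟨t₀, ht₀⟩ := h.area_eq_integral hγ
  have hψ := h.continuous_angle
  have hσ := h.continuous_speed
  have hk := h.continuous_curvature
  have hper : Function.Periodic (fun t => k t * σ t) P := fun t => by
    simp only [h.periodic_curvature t, h.periodic_speed t]
  -- In `k σ = ψ' + σ cos ψ` the first term integrates to `2π` and the second to the area.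
  have h1 := intervalIntegral.integral_eq_sub_of_hasDerivAt (a := t₀) (b := t₀ + P)
    (fun t _ => h.hasDerivAt_angle t) (by apply Continuous.intervalIntegrable; fun_prop)
  have h2 := hper.intervalIntegral_add_eq t₀ 0
  rw [zero_add] at h2
  rw [h.angle_add_period, add_sub_cancel_left] at h1
  rw [← h2, ht₀, ← h1, ← intervalIntegral.integral_add
    (by apply Continuous.intervalIntegrable; fun_prop)
    (by apply Continuous.intervalIntegrable; fun_prop)]
  refine intervalIntegral.integral_congr fun t _ => ?_
  ring

end FramedLoop
end HypCurve

/-! ### Conclusion -/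

theorem mainTheorem3 (γ : ℝ → ℍ) (P : ℝ) (hγ : HypCurve.IsSimpleClosed γ P)
    (hconv : ∀ t, 1 < HypCurve.curvature γ t) :
    HypCurve.averageCurvature γ P = (2 * Real.pi + HypCurve.area γ) / HypCurve.length γ P ∧
      4 ≤ (γ '' {t | HypCurve.curvature γ t =
        (2 * Real.pi + HypCurve.area γ) / HypCurve.length γ P}).encard := by
  obtain ⟨ψ, h⟩ := hγ.exists_framedLoop hconv
  have hGB := h.integral_curvature hγ.periodic
  have hL : 0 < HypCurve.length γ P :=
    intervalIntegral.integral_pos h.period_pos h.continuous_speed.continuousOn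
      (fun t _ => (h.speed_pos t).le) ⟨0, ⟨le_rfl, h.period_pos.le⟩, h.speed_pos 0⟩
  refine ⟨by rw [HypCurve.averageCurvature, hGB], ?_⟩
  set C := (2 * Real.pi + HypCurve.area γ) / HypCurve.length γ P with hC
  have hint : ∫ t in (0 : ℝ)..P, (HypCurve.curvature γ t - C) * HypCurve.speed γ t = 0 := by
    have hk := h.continuous_curvature
    have hσ := h.continuous_speed
    simp only [sub_mul]
    rw [intervalIntegral.integral_sub (by apply Continuous.intervalIntegrable; fun_prop)
      (by apply Continuous.intervalIntegrable; fun_prop), hGB,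
      intervalIntegral.integral_const_mul]
    change _ - C * HypCurve.length γ P = 0
    rw [hC, div_mul_cancel₀ _ hL.ne', sub_self]
  obtain ⟨p, hp⟩ := h.four_le_encard hint
  -- Injectivity on one period turns distinct parameters into distinct points of the curve.
  rw [← ((hγ.injOn_Ico p).mono fun t ht => ht.1).encard_image] at hp
  exact hp.trans (Set.encard_le_encard (Set.image_mono fun t ht => ht.2))
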